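/- **Setting.** Fix $d\in\mathbb N$ and let $L=2^d$. Let $\kappa\in\mathbb N$ denote the security parameter. For every $\kappa$ let $\mathcal V=\mathcal V_\kappa$ and $\mathcal R=\mathcal R_\kappa$ be finite sets (of values and of masking values) with $|\mathcal R|\ge 2^\kappa$, whose elements are written as bit strings in such a way that $(v,r)\mapsto v\|r$ is injective on $\mathcal V\times\mathcal R$. Let $\mathsf H:\{0,1\}^*\to\{0,1\}^\kappa$ be a random oracle, i.e. its values are independent and uniform on $\{0,1\}^\kappa$. **Construction.** Consider the complete binary tree of depth $d$. Its $j$-th node at height $n$ ($0\le n\le d$, $0\le j<2^{d-n}$, counted from the left) has as identifier $b\in\{0,1,*\}^d$ the $(d-n)$-bit binary representation of $j$ followed by $n$ stars, written as a bit string with two bits per symbol; $\operatorname{leaf}(i)$ is the identifier of the $i$-th leaf, $i\in[L]$, that is, the $d$-bit binary representation of $i-1$. Given $\mathbf v\in\mathcal V^L$ and $\mathbf r\in\mathcal R^L$, put $h_{\operatorname{leaf}(i)}=\mathsf H(\operatorname{leaf}(i)\|v_i\|r_i)$ for the leaves and $h_b=\mathsf H(b\|h_{b_L}\|h_{b_R})$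 for an interior node $b$ with left child $b_L$ and right child $b_R$. * $\mathsf{Commit}(\mathbf v,\mathbf r)$ is the hash of the root. * $\mathsf{Open}(\mathbf v,\mathbf r,i)$ is the list of the $d$ hashes of the siblings of the nodes on the path from leaf $i$ to the root. * $\mathsf{Verify}(C,i,v,r,w)$ starts from $\mathsf H(\operatorname{leaf}(i)\|v\|r)$, recomputes the hashes along the path from leaf $i$ to the root with the sibling hashes $w$, and outputs $1$ iff the result is $C$. An adversary is any probabilistic strategy (possibly computationally unbounded) with adaptive access to $\mathsf H$; it is *query-bounded* if its number of queries (to $\mathsf H$ and for openings) is at most $p(\kappa)$ for some polynomial $p$. In particular, every probabilistic polynomial-time adversary is query-bounded. A function $f$ is negligible if for every $c>0$ there is an $n_0$ with $f(n)<1/n^c$ for all $n\ge n_0$. **Lemma.** The construction is a vector commitment scheme that, in the random oracle model, satisfies: * **Correctness.** For every $\mathsf H$, all $\mathbf v\in\mathcal V^L$, $\mathbf r\in\mathcal R^L$ and $i\in[L]$: $\mathsf{Verify}(\mathsf{Commit}(\mathbf v,\mathbf r),i,v_i,r_i,\mathsf{Open}(\mathbf v,\mathbf r,i))=1$. * **Binding.**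 For every query-bounded adversary, the probability that it outputs $(\mathbf v,\mathbf v',\mathbf r,\mathbf r')$ with $(\mathbf v,\mathbf r)\ne(\mathbf v',\mathbf r')$ and $\mathsf{Commit}(\mathbf v,\mathbf r)=\mathsf{Commit}(\mathbf v',\mathbf r')$ is negligible in $\kappa$. More precisely, for every $\kappa$ it is at most $Q^2/2^\kappa$ with $Q=q+2(2L-1)$, if the adversary makes at most $q$ queries to $\mathsf H$. * **Position binding.** For every query-bounded adversary, the probability that it outputs $(C,i,v,v',r,r',w,w')$ with $(v,r)\ne(v',r')$ and $\mathsf{Verify}(C,i,v,r,w)=\mathsf{Verify}(C,i,v',r',w')=1$ is negligible in $\kappa$. More precisely, for every $\kappa$ it is at most $Q^2/2^\kappa$ with $Q=q+2(d+1)$, if the adversary makes at most $q$ queries to $\mathsf H$. * **Hiding.** Consider the following game. The adversary chooses $(\mathbf v^{(0)},\mathbf v^{(1)})$. The challenger draws a uniform bit $b$ and a uniform $\mathbf r\in\mathcal R^L$, independent of each other and of $\mathsf H$, and gives $C=\mathsf{Commit}(\mathbf v^{(b)},\mathbf r)$ to the adversary. The adversary may adaptively ask for openings $(r_i,\mathsf{Open}(\mathbf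 v^{(b)},\mathbf r,i))$ at indices $i$ with $v^{(0)}_i=v^{(1)}_i$. Finally it outputs a guess $\hat b\in\{0,1\}$. Throughout, it may query $\mathsf H$. For every query-bounded adversary, $|\Pr[\hat b=b]-\tfrac12|$ is negligible in $\kappa$. More precisely, for every $\kappa$ it is at most $q/2^\kappa$, if the adversary makes at most $q$ queries to $\mathsf H$. -/

import Mathlib

open scoped ENNReal

namespace SaltedMerkle

/-! ### Random oracle and adversaries -/

/-- Hash values: bit strings of length `κ`. -/
abbrev Hash (κ : ℕ) : Type := Fin κ → Bool

/-- Functions `{0,1}* → {0,1}^κ`. -/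
abbrev Oracle (κ : ℕ) : Type := List Bool → Hash κ

/-- The law of the random oracle: all values `H x`, for `x` in `{0,1}*`, are independent and
uniform on `{0,1}^κ`. -/
noncomputable def oracleLaw (κ : ℕ) : MeasureTheory.Measure (Oracle κ) :=
  MeasureTheory.Measure.infinitePi
    (fun _ : List Bool => (PMF.uniformOfFintype (Hash κ)).toMeasure)

/-- The probability of the event `E H x`, where `x` is drawn from `D` and, independently,
`H` is a random oracle. -/
noncomputable def romProb {κ : ℕ} {α : Type} (D : PMF α) (E : Oracle κ → α → Prop) : ℝ :=
  (∑' x, D x * oracleLaw κ {H | E H x}).toReal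

/-- Deterministic interactive strategies that adaptively ask finitely many questions `q : Q`,
get answers in `Ans q`, and finally output an element of `α`. No bound is put on the internal
computation. A probabilistic strategy is a `PMF` on deterministic ones. -/
inductive Interaction (Q : Type) (Ans : Q → Type) (α : Type) : Type
  | done (a : α) : Interaction Q Ans α
  | ask (q : Q) (next : Ans q → Interaction Q Ans α) : Interaction Q Ans α

namespace Interaction

variable {Q : Type} {Ans : Q → Type} {α : Type}

/-- The output, when every question `q` is answered by `answer q`. -/
def run (answer : ∀ q, Ans q) : Interaction Q Ans α → α
  | done a => a
  | ask q next => (next (answer q)).run answer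

/-- The list of the questions that are asked, when every `q` is answered by `answer q`. -/
def asked (answer : ∀ q, Ans q) : Interaction Q Ans α → List Q
  | done _ => []
  | ask q next => q :: (next (answer q)).asked answer

end Interaction

/-- Strategies with access to the random oracle. -/
abbrev OracleStrategy (κ : ℕ) (α : Type) : Type :=
  Interaction (List Bool) (fun _ => Hash κ) α

/-- `f` is negligible: it is eventually smaller than every inverse power. -/
def Negligible (f : ℕ → ℝ) : Prop :=
  ∀ c : ℝ, 0 < c → ∃ n₀ : ℕ, ∀ n : ℕ, n₀ ≤ n → f n < 1 / (n : ℝ) ^ c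

/-! ### Vector commitments in the random oracle model -/

/-- The three (deterministic) algorithms of a vector commitment scheme for vectors of length `L`
with values in `V` and masking values in `R`; all have access to the oracle. The index set
`{1, ..., L}` is `Fin L`, numbered from `0`. -/
structure VCScheme (κ L : ℕ) (V R : Type) where
  /-- commitments -/
  Com : Type
  /-- witnesses -/
  Wit : Type
  commit : Oracle κ → (Fin L → V) → (Fin L → R) → Com
  openAt : Oracle κ → (Fin L → V) → (Fin L → R) → Fin L → Wit
  verify : Oracle κ → Com → Fin L → V → R → Wit → Bool

namespace VCScheme

variable {κ L : ℕ} {V R : Type}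

/-- Honest openings verify. -/
def Correct (S : VCScheme κ L V R) : Prop :=
  ∀ (H : Oracle κ) (v : Fin L → V) (r : Fin L → R) (i : Fin L),
    S.verify H (S.commit H v r) i (v i) (r i) (S.openAt H v r i) = true

/-! #### Binding -/

/-- Strategies that output `(v, v', r, r')`. -/
abbrev BindingStrategy (_S : VCScheme κ L V R) : Type :=
  OracleStrategy κ ((Fin L → V) × (Fin L → V) × (Fin L → R) × (Fin L → R))

def BindingWin (S : VCScheme κ L V R) (H : Oracle κ) (a : S.BindingStrategy) : Prop :=
  match a.run H with
  | (v, v', r, r') => (v ≠ v' ∨ r ≠ r') ∧ S.commit H v r = S.commit H v' r'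

/-- The probability that the adversary `A` wins the binding game. -/
noncomputable def bindingProb (S : VCScheme κ L V R) (A : PMF S.BindingStrategy) : ℝ :=
  romProb A S.BindingWin

/-! #### Position binding -/

/-- Strategies that output `(C, i, v, v', r, r', w, w')`. -/
abbrev PositionStrategy (S : VCScheme κ L V R) : Type :=
  OracleStrategy κ (S.Com × Fin L × V × V × R × R × S.Wit × S.Wit)

def PositionWin (S : VCScheme κ L V R) (H : Oracle κ) (a : S.PositionStrategy) : Prop :=
  match a.run H with
  | (C, i, v, v', r, r', w, w') =>
    (v ≠ v' ∨ r ≠ r') ∧ S.verify H C i v r w = true ∧ S.verify H C i v' r' w' = true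

/-- The probability that the adversary `A` wins the position binding game. -/
noncomputable def positionProb (S : VCScheme κ L V R) (A : PMF S.PositionStrategy) : ℝ :=
  romProb A S.PositionWin

/-! #### Hiding -/

/-- What the adversary can ask after it has received the commitment: oracle queries (left)
and opening queries (right). An opening query that is not allowed is answered by `none`. -/
abbrev GuessAnswer (S : VCScheme κ L V R) : List Bool ⊕ Fin L → Type
  | .inl _ => Hash κ
  | .inr _ => Option (R × S.Wit)

/-- The second phase of the adversary: it makes oracle queries and opening queries and then
outputs a guess. -/
abbrev GuessStrategy (S : VCScheme κ L V R) : Type :=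
  Interaction (List Bool ⊕ Fin L) S.GuessAnswer Bool

/-- The adversary in the hiding game: with access to the oracle it chooses the two vectors
`vs false` and `vs true`, together with its continuation, which starts from the commitment. -/
abbrev HidingStrategy (S : VCScheme κ L V R) : Type :=
  OracleStrategy κ ((Bool → Fin L → V) × (S.Com → S.GuessStrategy))

open Classical in
/-- The answers of the challenger that has committed to `vs b` with randomness `r`: openings
are given exactly at the indices where the two vectors agree. -/
noncomputable def guessAnswer (S : VCScheme κ L V R) (H : Oracle κ) (vs : Bool → Fin L → V)
    (b : Bool) (r : Fin L → R) : ∀ q, S.GuessAnswer q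
  | .inl x => H x
  | .inr i =>
    if vs false i = vs true i then some (r i, S.openAt H (vs b) r i) else none

/-- The adversary's guess, when the challenger uses the bit `b` and randomness `r`. -/
noncomputable def hidingGuess (S : VCScheme κ L V R) (H : Oracle κ) (a : S.HidingStrategy)
    (b : Bool) (r : Fin L → R) : Bool :=
  match a.run H with
  | (vs, k) => (k (S.commit H (vs b) r)).run (S.guessAnswer H vs b r)

/-- The questions that the adversary asks in the second phase. -/
noncomputable def guessAsked (S : VCScheme κ L V R) (H : Oracle κ) (a : S.HidingStrategy)
    (b : Bool) (r : Fin L → R) : List (List Bool ⊕ Fin L) :=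
  match a.run H with
  | (vs, k) => (k (S.commit H (vs b) r)).asked (S.guessAnswer H vs b r)

/-- The number of all queries (to the oracle and for openings) of the adversary. -/
noncomputable def hidingQueries (S : VCScheme κ L V R) (H : Oracle κ) (a : S.HidingStrategy)
    (b : Bool) (r : Fin L → R) : ℕ :=
  (a.asked H).length + (S.guessAsked H a b r).length

/-- The number of oracle queries of the adversary, in both phases together. -/
noncomputable def hidingOracleQueries (S : VCScheme κ L V R) (H : Oracle κ)
    (a : S.HidingStrategy) (b : Bool) (r : Fin L → R) : ℕ :=
  (a.asked H).length + (S.guessAsked H a b r).countP Sum.isLeft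

/-- The probability that the adversary `A` guesses the bit `b`, where the bit and the
randomness `r` are uniform and independent of each other, of `A` and of the oracle. -/
noncomputable def hidingProb [Fintype R] [Nonempty R] (S : VCScheme κ L V R)
    (A : PMF S.HidingStrategy) : ℝ :=
  romProb
    (A.bind fun a => (PMF.uniformOfFintype Bool).bind fun b =>
      (PMF.uniformOfFintype (Fin L → R)).bind fun r => PMF.pure (a, b, r))
    (fun H (x : S.HidingStrategy × Bool × (Fin L → R)) =>
      S.hidingGuess H x.1 x.2.1 x.2.2 = x.2.1)

end VCScheme

/-- A family of vector commitment schemes, indexed by the security parameter `κ`, is correct,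
binding, position binding and hiding in the random oracle model. The adversaries are all
(possibly computationally unbounded) probabilistic strategies whose number of queries is bounded
by a polynomial in `κ`; this includes all probabilistic polynomial-time adversaries. -/
structure IsGoodVC {L : ℕ} {V R : ℕ → Type} [∀ κ, Fintype (R κ)] [∀ κ, Nonempty (R κ)]
    (S : ∀ κ, VCScheme κ L (V κ) (R κ)) : Prop where
  isCorrect : ∀ κ, (S κ).Correct
  isBinding : ∀ A : ∀ κ, PMF (S κ).BindingStrategy,
    (∃ p : Polynomial ℕ, ∀ κ, ∀ a ∈ (A κ).support, ∀ H : Oracle κ,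
      (a.asked H).length ≤ p.eval κ) →
    Negligible fun κ => (S κ).bindingProb (A κ)
  isPositionBinding : ∀ A : ∀ κ, PMF (S κ).PositionStrategy,
    (∃ p : Polynomial ℕ, ∀ κ, ∀ a ∈ (A κ).support, ∀ H : Oracle κ,
      (a.asked H).length ≤ p.eval κ) →
    Negligible fun κ => (S κ).positionProb (A κ)
  isHiding : ∀ A : ∀ κ, PMF (S κ).HidingStrategy,
    (∃ p : Polynomial ℕ, ∀ κ, ∀ a ∈ (A κ).support, ∀ (H : Oracle κ) (b : Bool)
      (r : Fin L → R κ), (S κ).hidingQueries H a b r ≤ p.eval κ) →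
    Negligible fun κ => |(S κ).hidingProb (A κ) - 1 / 2|

/-! ### The Merkle tree with a random salt at each leaf -/

/-- The identifier in `{0,1,*}^d` of the `j`-th node (counted from `0` on the left) at height `n`
of a complete binary tree of depth `d`: the `(d - n)`-bit binary representation of `j`, most
significant bit first, followed by `n` stars; `none` is the star. -/
def nodeId (d n j : ℕ) : List (Option Bool) :=
  List.ofFn fun t : Fin d =>
    if d - 1 - t < n then none else some (j.testBit (d - 1 - t - n))

/-- Two bits for each symbol of an identifier. -/
def symbolBits : Option Bool → List Bool
  | none => [true, true]
  | some b => [false, b]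

/-- The identifier of a node as a bit string. -/
def nodeBits (d n j : ℕ) : List Bool := (nodeId d n j).flatMap symbolBits

section Tree

variable {κ d : ℕ}

/-- The hash of the interior node with children hashes `h₀` (left) and `h₁` (right). -/
def interiorHash (H : Oracle κ) (d n j : ℕ) (h₀ h₁ : Hash κ) : Hash κ :=
  H (nodeBits d n j ++ List.ofFn h₀ ++ List.ofFn h₁)

variable {V R : Type} (encV : V → List Bool) (encR : R → List Bool)

/-- The hash `H (leaf j ‖ v ‖ r)` of a leaf. -/
def leafHash (H : Oracle κ) (d j : ℕ) (v : V) (r : R) : Hash κ :=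
  H (nodeBits d 0 j ++ encV v ++ encR r)

/-- The hash of the `j`-th node at height `n` in the tree with leaf hashes `leaf`. -/
def nodeHash (H : Oracle κ) (d : ℕ) (leaf : ℕ → Hash κ) : ℕ → ℕ → Hash κ
  | 0, j => leaf j
  | n + 1, j =>
    interiorHash H d (n + 1) j
      (nodeHash H d leaf n (2 * j)) (nodeHash H d leaf n (2 * j + 1))

/-- The leaf hashes of the tree for `(v, r)`; the value for `2 ^ d ≤ j` is never used. -/
def leafHashes (H : Oracle κ) (v : Fin (2 ^ d) → V) (r : Fin (2 ^ d) → R) (j : ℕ) : Hash κ :=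
  if h : j < 2 ^ d then leafHash encV encR H d j (v ⟨j, h⟩) (r ⟨j, h⟩) else fun _ => false

/-- The sibling of the `j`-th node at some height. -/
def sibling (j : ℕ) : ℕ := if j % 2 = 0 then j + 1 else j - 1

/-- The hash at height `n` on the path from leaf `i` to the root, recomputed from the leaf hash
`h` and the sibling hashes `w`. -/
def pathHash (H : Oracle κ) (i : ℕ) (h : Hash κ) (w : Fin d → Hash κ) : ∀ n : ℕ, n ≤ d → Hash κ
  | 0, _ => h
  | n + 1, hn =>
    if i / 2 ^ n % 2 = 0 then
      interiorHash H d (n + 1) (i / 2 ^ (n + 1))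
        (pathHash H i h w n (Nat.le_of_succ_le hn)) (w ⟨n, hn⟩)
    else
      interiorHash H d (n + 1) (i / 2 ^ (n + 1))
        (w ⟨n, hn⟩) (pathHash H i h w n (Nat.le_of_succ_le hn))

end Tree

/-- The salted Merkle tree of depth `d` as a vector commitment scheme for vectors of length
`2 ^ d`. The commitment is the root hash; the witness for index `i` consists of the hashes of
the siblings of the nodes on the path from leaf `i` to the root. -/
def merkleVC (κ d : ℕ) {V R : Type} (encV : V → List Bool) (encR : R → List Bool) :
    VCScheme κ (2 ^ d) V R where
  Com := Hash κ
  Wit := Fin d → Hash κ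
  commit H v r := nodeHash H d (leafHashes encV encR H v r) d 0
  openAt H v r i n := nodeHash H d (leafHashes encV encR H v r) n (sibling (i / 2 ^ (n : ℕ)))
  verify H C i v r w := decide (pathHash H i (leafHash encV encR H d i v r) w d le_rfl = C)

end SaltedMerkle

/-! Correctness is an induction along the path from the leaf to the root.

Both binding properties come down to collisions. The adversary is prolonged by the computation of
the two commitments, or of the two verifications, that decide whether it wins; this accounts for the
extra `2 * (2 ^ (d + 1) - 1)` or `2 * (d + 1)` questions. If `H` is injective on the points asked,
equal roots force equal inputs one level further down, and so on to the leaves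
(`leaves_eq_of_nodeHash_eq`, `leaf_eq_of_pathHash_eq`). So a win produces a collision among the
questions, and `oracleLaw_collision_le` bounds its probability.

Hiding rests on two measure-preserving symmetries of the game. Call a point secret if it is a leaf
point with the challenger's salt, at a leaf where the two vectors differ. Exchanging the oracle's
values at the two candidate values of each leaf, for the challenger's salts, and flipping `b`
changes nothing that the adversary sees as long as it asks no secret point. Hence wins and losses
balance on the samples where no secret is asked (`card_win_le`), and the advantage is at most half
the probability of asking a secret.

To bound that probability, draw independent salts `ρ` as well. A point asked is secret for `ρ` with
probability at most `1 / |R|`, so the `q` oracle queries hit `ρ` with probability at most `q / |R|`.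
Exchanging the roles of the two salt vectors, in the oracle too, shows that the true salts are hit
at most twice as often (`card_asksSecret_le`). The factors `2` and `1 / 2` cancel, which gives `q /
2 ^ κ`.

A strategy depends on finitely many oracle values only, so probabilities are relative frequencies
among finite tables (`oracleLaw_eq_div`). Symmetries then become injections between finite sets. -/

namespace SaltedMerkle

/-! ### Runs of interactive strategies -/

namespace Interaction

variable {Q : Type} {Ans : Q → Type} {α β : Type}

theorem run_asked_congr {f g : ∀ q, Ans q} (s : Interaction Q Ans α)
    (h : ∀ q ∈ s.asked f, f q = g q) : s.run f = s.run g ∧ s.asked f = s.asked g := by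
  induction s with
  | done a => exact ⟨rfl, rfl⟩
  | ask q next ih =>
    have hq : f q = g q := h q (by simp [asked])
    have := ih (f q) (fun x hx => h x (by simp [asked, hx]))
    simp only [run, asked, ← hq]
    exact ⟨this.1, by rw [this.2]⟩

/-- A question is chosen from the earlier answers alone, so `j` answers fix one question more than
they answer. The extra one is what allows the oracle to be changed at the `j`-th question (counted
from `0`) without moving that question. -/
theorem take_asked_congr {f g : ∀ q, Ans q} (s : Interaction Q Ans α) (j : ℕ)
    (h : ∀ q ∈ (s.asked f).take j, f q = g q) :
    (s.asked f).take (j + 1) = (s.asked g).take (j + 1) := by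
  induction s generalizing j with
  | done a => rfl
  | ask q next ih =>
    cases j with
    | zero => simp [asked]
    | succ j =>
      have hq : f q = g q := h q (by simp [asked])
      have := ih (f q) j (fun x hx => h x (by simp [asked, hx]))
      simp only [asked, ← hq, List.take_succ_cons] at this ⊢
      rw [this]

/-- If two ways to answer differ only at bad questions, and one run meets a bad question, then
both runs meet a common bad question. -/
theorem exists_common_asked {f g : ∀ q, Ans q} {Bad : Q → Prop}
    (hfg : ∀ q, ¬ Bad q → f q = g q) (s : Interaction Q Ans α)
    (h : ∃ q ∈ s.asked f, Bad q) : ∃ q ∈ s.asked f, q ∈ s.asked g ∧ Bad q := by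
  induction s with
  | done a => simp [asked] at h
  | ask q next ih =>
    by_cases hq : Bad q
    · exact ⟨q, by simp [asked], by simp [asked], hq⟩
    · obtain ⟨x, hx, hb⟩ := h
      have hx' : x ∈ (next (f q)).asked f := by
        rcases List.mem_cons.1 hx with rfl | hx
        · exact absurd hb hq
        · exact hx
      obtain ⟨y, hy, hy', hb'⟩ := ih (f q) ⟨x, hx', hb⟩
      refine ⟨y, List.mem_cons_of_mem _ hy, ?_, hb'⟩
      simp only [asked, ← hfg q hq]
      exact List.mem_cons_of_mem _ hy'

/-- Run one interaction and continue with its output. -/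
def bind : Interaction Q Ans α → (α → Interaction Q Ans β) → Interaction Q Ans β
  | done a, k => k a
  | ask q next, k => ask q fun x => (next x).bind k

theorem run_bind (f : ∀ q, Ans q) (s : Interaction Q Ans α) (k : α → Interaction Q Ans β) :
    (s.bind k).run f = (k (s.run f)).run f := by
  induction s with
  | done a => rfl
  | ask q next ih => exact ih (f q)

theorem asked_bind (f : ∀ q, Ans q) (s : Interaction Q Ans α) (k : α → Interaction Q Ans β) :
    (s.bind k).asked f = s.asked f ++ (k (s.run f)).asked f := by
  induction s with
  | done a => rfl
  | ask q next ih => simp only [bind, asked, run, List.cons_append, ih (f q)]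

/-- The strategy is a well-founded tree with finite branching, so it has finitely many nodes. -/
theorem exists_finite_asked [∀ q, Finite (Ans q)] (s : Interaction Q Ans α) :
    ∃ F : Set Q, F.Finite ∧ ∀ f, ∀ q ∈ s.asked f, q ∈ F := by
  induction s with
  | done a => exact ⟨∅, Set.finite_empty, by simp [asked]⟩
  | ask q next ih =>
    choose F hF hF' using ih
    refine ⟨insert q (⋃ x, F x), (Set.finite_iUnion hF).insert q, fun f y hy => ?_⟩
    rcases List.mem_cons.1 hy with rfl | hy
    · exact Set.mem_insert _ _
    · exact Set.mem_insert_of_mem _ (Set.mem_iUnion.2 ⟨_, hF' _ f y hy⟩)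

end Interaction

/-! ### Probabilities as relative frequencies -/

section Tables

variable {κ : ℕ}

/-- Extension by zero of a function on a finite set of bit strings. -/
def extendTable (F : Finset (List Bool)) (h : F → Hash κ) : Oracle κ :=
  fun x => if hx : x ∈ F then h ⟨x, hx⟩ else fun _ => false

theorem restrict_extendTable (F : Finset (List Bool)) (h : F → Hash κ) :
    F.restrict (extendTable F h) = h := by
  funext x
  simp [extendTable]

theorem extendTable_restrict (F : Finset (List Bool)) {H : Oracle κ}
    (hH : ∀ x ∉ F, H x = fun _ => false) : extendTable F (F.restrict H) = H := by
  funext x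
  by_cases hx : x ∈ F
  · simp [extendTable, hx]
  · simp [extendTable, hx, hH x hx]

/-- The oracles that vanish outside the finite set `F`. -/
noncomputable def tables (κ : ℕ) (F : Finset (List Bool)) : Finset (Oracle κ) :=
  Finset.univ.map ⟨extendTable F, Function.LeftInverse.injective (restrict_extendTable F)⟩

theorem mem_tables {F : Finset (List Bool)} {H : Oracle κ} :
    H ∈ tables κ F ↔ ∀ x ∉ F, H x = fun _ => false := by
  constructor
  · intro h x hx
    obtain ⟨h, -, rfl⟩ := Finset.mem_map.1 h
    simp [extendTable, hx]
  · intro h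
    exact Finset.mem_map.2 ⟨F.restrict H, Finset.mem_univ _, extendTable_restrict F h⟩

theorem tables_nonempty (F : Finset (List Bool)) : (tables κ F).Nonempty :=
  ⟨fun _ _ => false, mem_tables.2 fun _ _ => rfl⟩

-- This is the passage from the infinite product measure to counting: the event is a cylinder over
-- `F`, and all tables on `F` have the same mass.
open Classical in
theorem oracleLaw_eq_div (F : Finset (List Bool)) {E : Oracle κ → Prop}
    (hE : DependsOn E (F : Set (List Bool))) :
    oracleLaw κ {H | E H} = ((tables κ F).filter E).card / (tables κ F).card := by
  have h1 : {H : Oracle κ | E H} =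
      MeasureTheory.cylinder F {h : F → Hash κ | E (extendTable F h)} := by
    ext H
    simp only [Set.mem_ofPred_eq, MeasureTheory.mem_cylinder]
    refine (hE fun x hx => ?_).to_iff
    have hx' : x ∈ F := hx
    simp [extendTable, hx']
  have h2 : ((tables κ F).filter E).card =
      (Finset.univ.filter fun h : F → Hash κ => E (extendTable F h)).card := by
    rw [tables, Finset.filter_map, Finset.card_map]
    rfl
  have h3 : {h : F → Hash κ | E (extendTable F h)} =
      ((Finset.univ.filter fun h : F → Hash κ => E (extendTable F h) : Finset _) : Set _) := by
    ext; simp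
  have h4 : ∀ h : F → Hash κ,
      MeasureTheory.Measure.pi (fun _ : F => (PMF.uniformOfFintype (Hash κ)).toMeasure) {h} =
        ((tables κ F).card : ℝ≥0∞)⁻¹ := by
    intro h
    have h5 : ∀ x : Hash κ, (PMF.uniformOfFintype (Hash κ)).toMeasure {x} =
        (Fintype.card (Hash κ) : ℝ≥0∞)⁻¹ := fun x => by
      rw [PMF.toMeasure_apply_singleton _ _ (MeasurableSet.singleton x),
        PMF.uniformOfFintype_apply]
    rw [← Set.univ_pi_singleton, MeasureTheory.Measure.pi_pi, Finset.prod_congr rfl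
      fun i _ => h5 (h i), Finset.prod_const, tables, Finset.card_map, Finset.card_univ,
      Finset.card_univ, Fintype.card_fun (α := F), Nat.cast_pow, ENNReal.inv_pow]
  rw [h1, oracleLaw, MeasureTheory.Measure.infinitePi_cylinder _ (Set.toFinite _).measurableSet,
    h3, ← MeasureTheory.sum_measure_singleton, Finset.sum_congr rfl fun h _ => h4 h,
    Finset.sum_const, h2, nsmul_eq_mul, ENNReal.div_eq_inv_mul, mul_comm]

/-! ### Collisions -/

variable {α : Type}

/-- Compare the first occurrences of `x` and `y`; the element that shows up later is fresh at that
moment. A collision can thus be charged to a fresh question, whose answer is still uniform. -/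
theorem exists_first_occurrences {β : Type} {l : List β} {x y : β} (hx : x ∈ l)
    (hy : y ∈ l) (hxy : x ≠ y) : ∃ i j a b, i < j ∧ j < l.length ∧ l[i]? = some a ∧
      l[j]? = some b ∧ b ∉ l.take j ∧ (a = x ∧ b = y ∨ a = y ∧ b = x) := by
  classical
  rcases lt_or_gt_of_ne fun h => hxy ((List.idxOf_inj hx).1 h) with h | h
  · exact ⟨_, _, _, _, h, List.idxOf_lt_length_of_mem hy, List.getElem?_idxOf hx,
      List.getElem?_idxOf hy, fun h => lt_irrefl _ ((List.mem_take_iff_idxOf_lt hy).1 h),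
      Or.inl ⟨rfl, rfl⟩⟩
  · exact ⟨_, _, _, _, h, List.idxOf_lt_length_of_mem hx, List.getElem?_idxOf hy,
      List.getElem?_idxOf hx, fun h => lt_irrefl _ ((List.mem_take_iff_idxOf_lt hx).1 h),
      Or.inr ⟨rfl, rfl⟩⟩

/-- The `j`-th question is new and its answer equals that to the `i`-th question. -/
def CollidesAt (s : OracleStrategy κ α) (i j : ℕ) (H : Oracle κ) : Prop :=
  ∃ x y, (s.asked H)[i]? = some x ∧ (s.asked H)[j]? = some y ∧
    y ∉ (s.asked H).take j ∧ H x = H y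

-- The answer to the fresh `j`-th question can be overwritten by any of the `2 ^ κ` hashes. The
-- overwritten oracle still asks the same first `j + 1` questions, and the lost answer can be read
-- off at the `i`-th one, so the pair of oracle and hash is recovered.
open Classical in
theorem card_collidesAt_mul_le (s : OracleStrategy κ α) {F : Finset (List Bool)}
    (hF : ∀ H, ∀ x ∈ s.asked H, x ∈ F) {i j : ℕ} (hij : i < j) :
    ((tables κ F).filter (CollidesAt s i j)).card * 2 ^ κ ≤ (tables κ F).card := by
  have hcard : (2 : ℕ) ^ κ = (Finset.univ : Finset (Hash κ)).card := by
    simp [Finset.card_univ]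
  rw [hcard, ← Finset.card_product]
  have key : ∀ (H : Oracle κ) (x y : List Bool) (h : Hash κ), (s.asked H)[i]? = some x →
      (s.asked H)[j]? = some y → y ∉ (s.asked H).take j →
      (s.asked (Function.update H y h))[i]? = some x ∧
      (s.asked (Function.update H y h))[j]? = some y ∧ x ≠ y := by
    intro H x y h hx hy hn
    have ht := Interaction.take_asked_congr (f := H) (g := Function.update H y h) s j
      (fun q hq => by
        rw [Function.update_of_ne]
        rintro rfl
        exact hn hq)
    refine ⟨?_, ?_, ?_⟩
    · rw [← hx, ← List.getElem?_take_of_lt (l := s.asked H) (show i < j + 1 by omega), ht,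
        List.getElem?_take_of_lt (show i < j + 1 by omega)]
    · rw [← hy, ← List.getElem?_take_of_lt (l := s.asked H) (show j < j + 1 by omega), ht,
        List.getElem?_take_of_lt (show j < j + 1 by omega)]
    · rintro rfl
      exact hn (List.mem_of_getElem? (i := i) (by rw [List.getElem?_take_of_lt hij, hx]))
  -- The default `[]` plays no role: in the event counted, the `j`-th question exists.
  refine Finset.card_le_card_of_injOn
    (fun z => Function.update z.1 ((s.asked z.1)[j]?.getD []) z.2) ?_ ?_
  · rintro ⟨H, h⟩ hz
    obtain ⟨hH, x, y, hx, hy, hn, hc⟩ := Finset.mem_filter.1 (Finset.mem_product.1 hz).1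
    refine mem_tables.2 fun u hu => ?_
    have : u ≠ y := by
      rintro rfl
      exact hu (hF H _ (List.mem_of_getElem? hy))
    simp only [hy, Option.getD_some, Function.update_of_ne this]
    exact mem_tables.1 hH u hu
  · rintro ⟨H, h⟩ hz ⟨H', h'⟩ hz' heq
    obtain ⟨hH, x, y, hx, hy, hn, hc⟩ := Finset.mem_filter.1 (Finset.mem_product.1 hz).1
    obtain ⟨hH', x', y', hx', hy', hn', hc'⟩ := Finset.mem_filter.1 (Finset.mem_product.1 hz').1
    simp only at hx hy hn hc hx' hy' hn' hc'
    simp only [hy, hy', Option.getD_some] at heq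
    obtain ⟨k1, k2, k3⟩ := key H x y h hx hy hn
    obtain ⟨k1', k2', k3'⟩ := key H' x' y' h' hx' hy' hn'
    rw [heq, k2'] at k2
    rw [heq, k1'] at k1
    obtain rfl : y' = y := by simpa using k2
    obtain rfl : x' = x := by simpa using k1
    have hh : h = h' := by simpa using congrFun heq y'
    have hne : ∀ u, u ≠ y' → H u = H' u := fun u hu => by
      simpa [Function.update_of_ne hu] using congrFun heq u
    have hHH : H = H' := by
      funext u
      by_cases hu : u = y'
      -- At the overwritten point the collision gives the old value back from the untouched point
      -- `x'`.
      · rw [hu, ← hc, ← hc', hne _ k3]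
      · exact hne u hu
    rw [hh, hHH]

/-- A strategy that asks at most `q` questions meets a collision with probability at most
`q ^ 2 / 2 ^ κ`. -/
theorem oracleLaw_collision_le (s : OracleStrategy κ α) {q : ℕ}
    (hs : ∀ H, (s.asked H).length ≤ q) :
    oracleLaw κ {H | ∃ x ∈ s.asked H, ∃ y ∈ s.asked H, x ≠ y ∧ H x = H y} ≤
      ENNReal.ofReal ((q : ℝ) ^ 2 / 2 ^ κ) := by
  classical
  obtain ⟨F, hfin, hF⟩ := s.exists_finite_asked
  lift F to Finset (List Bool) using hfin
  rw [oracleLaw_eq_div F]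
  · have h1 : ((tables κ F).filter
        fun H => ∃ x ∈ s.asked H, ∃ y ∈ s.asked H, x ≠ y ∧ H x = H y) ⊆
        ((Finset.range q ×ˢ Finset.range q).filter fun p => p.1 < p.2).biUnion
          fun p => (tables κ F).filter (CollidesAt s p.1 p.2) := by
      intro H hH
      obtain ⟨hH, x, hx, y, hy, hxy, hc⟩ := Finset.mem_filter.1 hH
      obtain ⟨i, j, a, b, hij, hj, ha, hb, hn, hab⟩ := exists_first_occurrences hx hy hxy
      simp only [Finset.mem_biUnion, Finset.mem_filter, Finset.mem_product, Finset.mem_range]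
      refine ⟨(i, j), ⟨⟨(hij.trans hj).trans_le (hs H), hj.trans_le (hs H)⟩, hij⟩, hH,
        a, b, ha, hb, hn, ?_⟩
      rcases hab with ⟨rfl, rfl⟩ | ⟨rfl, rfl⟩
      · exact hc
      · exact hc.symm
    have h2 : ((tables κ F).filter
        fun H => ∃ x ∈ s.asked H, ∃ y ∈ s.asked H, x ≠ y ∧ H x = H y).card * 2 ^ κ ≤
        q ^ 2 * (tables κ F).card := by
      calc _ ≤ (∑ p ∈ (Finset.range q ×ˢ Finset.range q).filter fun p => p.1 < p.2,
            ((tables κ F).filter (CollidesAt s p.1 p.2)).card) * 2 ^ κ :=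
            Nat.mul_le_mul_right _ ((Finset.card_le_card h1).trans Finset.card_biUnion_le)
        _ ≤ ∑ p ∈ (Finset.range q ×ˢ Finset.range q).filter fun p => p.1 < p.2,
            (tables κ F).card := by
            rw [Finset.sum_mul]
            exact Finset.sum_le_sum fun p hp =>
              card_collidesAt_mul_le s hF (Finset.mem_filter.1 hp).2
        _ ≤ q ^ 2 * (tables κ F).card := by
            rw [Finset.sum_const, smul_eq_mul]
            refine Nat.mul_le_mul_right _ ((Finset.card_filter_le _ _).trans ?_)
            rw [Finset.card_product, Finset.card_range, sq]
    have hpos : 0 < (tables κ F).card := (tables_nonempty F).card_pos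
    rw [← ENNReal.ofReal_natCast, ← ENNReal.ofReal_natCast,
      ← ENNReal.ofReal_div_of_pos (by exact_mod_cast hpos)]
    refine ENNReal.ofReal_le_ofReal ?_
    rw [div_le_div_iff₀ (by exact_mod_cast hpos) (by positivity)]
    exact_mod_cast h2
  · intro H H' hHH
    have := (s.run_asked_congr fun x hx => hHH x (hF H x hx)).2
    refine propext ⟨?_, ?_⟩
    · rintro ⟨x, hx, y, hy, hxy, hc⟩
      exact ⟨x, this ▸ hx, y, this ▸ hy, hxy,
        by rw [← hHH x (hF H x hx), ← hHH y (hF H y hy), hc]⟩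
    · rintro ⟨x, hx, y, hy, hxy, hc⟩
      rw [← this] at hx hy
      exact ⟨x, hx, y, hy, hxy, by rw [hHH x (hF H x hx), hHH y (hF H y hy), hc]⟩

/-- A bound that is uniform over deterministic strategies survives averaging over the adversary's
coins. -/
theorem romProb_le {D : PMF α} {E : Oracle κ → α → Prop} {c : ℝ} (hc : 0 ≤ c)
    (h : ∀ x ∈ D.support, oracleLaw κ {H | E H x} ≤ ENNReal.ofReal c) : romProb D E ≤ c := by
  refine ENNReal.toReal_le_of_le_ofReal hc ?_
  calc ∑' x, D x * oracleLaw κ {H | E H x} ≤ ∑' x, D x * ENNReal.ofReal c := by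
        refine ENNReal.tsum_le_tsum fun x => ?_
        by_cases hx : x ∈ D.support
        · gcongr
          exact h x hx
        · rw [PMF.mem_support_iff, not_not] at hx
          simp [hx]
    _ = ENNReal.ofReal c := by rw [ENNReal.tsum_mul_right, D.tsum_coe, one_mul]

end Tables

section Merkle

variable {κ d : ℕ} {V R : Type} {encV : V → List Bool} {encR : R → List Bool}

/-! ### Correctness -/

theorem pathHash_sibling (H : Oracle κ) (leaf : ℕ → Hash κ) (i n : ℕ) (hn : n ≤ d) :
    pathHash H i (leaf i)
      (fun m : Fin d => nodeHash H d leaf m (sibling (i / 2 ^ (m : ℕ)))) n hn =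
      nodeHash H d leaf n (i / 2 ^ n) := by
  induction n with
  | zero => simp [pathHash, nodeHash]
  | succ n ih =>
    have hdiv : i / 2 ^ (n + 1) = i / 2 ^ n / 2 := by rw [pow_succ, Nat.div_div_eq_div_mul]
    rw [pathHash, nodeHash, ih]
    simp only [hdiv, sibling]
    generalize i / 2 ^ n = m
    -- The parity of `m` decides whether the path enters its parent from the left or the right; the
    -- sibling fills the other slot.
    split_ifs with h
    · rw [show 2 * (m / 2) = m by omega]
    · rw [show 2 * (m / 2) = m - 1 by omega, show m - 1 + 1 = m by omega]

theorem leafHashes_of_fin (H : Oracle κ) (v : Fin (2 ^ d) → V) (r : Fin (2 ^ d) → R)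
    (i : Fin (2 ^ d)) :
    leafHashes encV encR H v r i = leafHash encV encR H d i (v i) (r i) := by
  simp [leafHashes]

theorem merkleVC_correct : (merkleVC κ d encV encR).Correct := by
  intro H v r i
  have h := pathHash_sibling (d := d) H (leafHashes encV encR H v r) i d le_rfl
  rw [leafHashes_of_fin, Nat.div_eq_of_lt i.2] at h
  simpa [merkleVC] using h

/-! ### The algorithms as strategies -/

/-- Ask for the hash of an interior node. -/
def interiorStrategy (d n j : ℕ) (h₀ h₁ : Hash κ) : OracleStrategy κ (Hash κ) :=
  .ask (nodeBits d n j ++ List.ofFn h₀ ++ List.ofFn h₁) .done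

/-- Ask for the hash of a leaf. -/
def leafStrategy (κ : ℕ) (encV : V → List Bool) (encR : R → List Bool) (d j : ℕ) (v : V) (r : R) :
    OracleStrategy κ (Hash κ) :=
  .ask (nodeBits d 0 j ++ encV v ++ encR r) .done

/-- Compute the hash of a node of the tree. -/
def nodeStrategy (κ : ℕ) (encV : V → List Bool) (encR : R → List Bool) (v : Fin (2 ^ d) → V)
    (r : Fin (2 ^ d) → R) : ℕ → ℕ → OracleStrategy κ (Hash κ)
  | 0, j => if h : j < 2 ^ d then leafStrategy κ encV encR d j (v ⟨j, h⟩) (r ⟨j, h⟩)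
      else .done fun _ => false
  | n + 1, j =>
    (nodeStrategy κ encV encR v r n (2 * j)).bind fun h₀ =>
      (nodeStrategy κ encV encR v r n (2 * j + 1)).bind fun h₁ =>
        interiorStrategy d (n + 1) j h₀ h₁

theorem run_nodeStrategy (H : Oracle κ) (v : Fin (2 ^ d) → V) (r : Fin (2 ^ d) → R) (n j : ℕ) :
    (nodeStrategy κ encV encR v r n j).run H =
      nodeHash H d (leafHashes encV encR H v r) n j := by
  induction n generalizing j with
  | zero =>
    simp only [nodeStrategy, nodeHash, leafHashes]
    split_ifs <;> rfl
  | succ n ih =>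
    simp only [nodeStrategy, Interaction.run_bind, ih]
    rfl

theorem length_asked_nodeStrategy (H : Oracle κ) (v : Fin (2 ^ d) → V) (r : Fin (2 ^ d) → R)
    (n j : ℕ) : ((nodeStrategy κ encV encR v r n j).asked H).length ≤ 2 ^ (n + 1) - 1 := by
  induction n generalizing j with
  | zero =>
    simp only [nodeStrategy]
    split_ifs <;> simp [leafStrategy, Interaction.asked]
  | succ n ih =>
    have h0 := ih (2 * j)
    have h1 := ih (2 * j + 1)
    have : 0 < 2 ^ n := by positivity
    simp only [nodeStrategy, Interaction.asked_bind, List.length_append, interiorStrategy,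
      Interaction.asked, List.length_cons, List.length_nil]
    rw [pow_succ] at h0 h1 ⊢
    rw [pow_succ]
    omega

/-- Recompute the hashes along a path. -/
def pathStrategy (i : ℕ) (leaf : OracleStrategy κ (Hash κ)) (w : Fin d → Hash κ) :
    ∀ n : ℕ, n ≤ d → OracleStrategy κ (Hash κ)
  | 0, _ => leaf
  | n + 1, hn =>
    (pathStrategy i leaf w n (Nat.le_of_succ_le hn)).bind fun h =>
      if i / 2 ^ n % 2 = 0 then interiorStrategy d (n + 1) (i / 2 ^ (n + 1)) h (w ⟨n, hn⟩)
      else interiorStrategy d (n + 1) (i / 2 ^ (n + 1)) (w ⟨n, hn⟩) h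

theorem run_pathStrategy (H : Oracle κ) (i : ℕ) (leaf : OracleStrategy κ (Hash κ))
    (w : Fin d → Hash κ) (n : ℕ) (hn : n ≤ d) :
    (pathStrategy i leaf w n hn).run H = pathHash H i (leaf.run H) w n hn := by
  induction n with
  | zero => rfl
  | succ n ih =>
    simp only [pathStrategy, Interaction.run_bind, ih, pathHash]
    split_ifs <;> rfl

theorem length_asked_pathStrategy (H : Oracle κ) (i : ℕ) (leaf : OracleStrategy κ (Hash κ))
    (w : Fin d → Hash κ) (n : ℕ) (hn : n ≤ d) :
    ((pathStrategy i leaf w n hn).asked H).length = (leaf.asked H).length + n := by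
  induction n with
  | zero => rfl
  | succ n ih =>
    simp only [pathStrategy, Interaction.asked_bind, List.length_append, ih]
    split_ifs <;> simp [interiorStrategy, Interaction.asked] <;> omega

/-! ### Binding -/

theorem append_ofFn_inj {l : List Bool} {a b a' b' : Hash κ}
    (h : l ++ List.ofFn a ++ List.ofFn b = l ++ List.ofFn a' ++ List.ofFn b') :
    a = a' ∧ b = b' := by
  rw [List.append_assoc, List.append_assoc] at h
  obtain ⟨h1, h2⟩ := List.append_inj (List.append_cancel_left h) (by simp)
  exact ⟨List.ofFn_injective h1, List.ofFn_injective h2⟩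

theorem leaf_inj (henc : Function.Injective fun x : V × R => encV x.1 ++ encR x.2)
    {l : List Bool} {v v' : V} {r r' : R}
    (h : l ++ encV v ++ encR r = l ++ encV v' ++ encR r') : v = v' ∧ r = r' := by
  rw [List.append_assoc, List.append_assoc] at h
  exact Prod.mk.inj (henc (a₁ := (v, r)) (a₂ := (v', r')) (List.append_cancel_left h))

/-- If the oracle has no collision among the points that are needed to compute two equal node
hashes, then the leaves below the node coincide. -/
theorem leaves_eq_of_nodeHash_eq
    (henc : Function.Injective fun x : V × R => encV x.1 ++ encR x.2) {H : Oracle κ}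
    {S : Set (List Bool)} (hS : Set.InjOn H S) {v v' : Fin (2 ^ d) → V} {r r' : Fin (2 ^ d) → R}
    {n j : ℕ} (h1 : ∀ x ∈ (nodeStrategy κ encV encR v r n j).asked H, x ∈ S)
    (h2 : ∀ x ∈ (nodeStrategy κ encV encR v' r' n j).asked H, x ∈ S)
    (heq : nodeHash H d (leafHashes encV encR H v r) n j =
      nodeHash H d (leafHashes encV encR H v' r') n j)
    (m : Fin (2 ^ d)) (hm : (m : ℕ) / 2 ^ n = j) : v m = v' m ∧ r m = r' m := by
  induction n generalizing j with
  | zero =>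
    obtain rfl : (m : ℕ) = j := by simpa using hm
    simp only [nodeStrategy, m.2, dif_pos, leafStrategy, Interaction.asked, List.mem_singleton,
      forall_eq, Fin.eta] at h1 h2
    simp only [nodeHash, leafHashes_of_fin] at heq
    exact leaf_inj henc (hS h1 h2 heq)
  | succ n ih =>
    simp only [nodeStrategy, Interaction.asked_bind, List.mem_append, interiorStrategy,
      Interaction.asked, List.mem_singleton, run_nodeStrategy] at h1 h2
    have h3 := append_ofFn_inj (hS (h1 _ (Or.inr (Or.inr rfl))) (h2 _ (Or.inr (Or.inr rfl))) heq)
    rw [pow_succ, ← Nat.div_div_eq_div_mul] at hm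
    -- The parity tells under which child of the node the leaf `m` lies.
    rcases Nat.even_or_odd' ((m : ℕ) / 2 ^ n) with ⟨t, ht | ht⟩
    · obtain rfl : t = j := by omega
      exact ih (fun x hx => h1 x (Or.inl hx)) (fun x hx => h2 x (Or.inl hx)) h3.1 ht
    · obtain rfl : t = j := by omega
      exact ih (fun x hx => h1 x (Or.inr (Or.inl hx))) (fun x hx => h2 x (Or.inr (Or.inl hx)))
        h3.2 ht

/-- Both recomputations follow the same index `i`, so at each level they put the running hash in the
same slot. Injectivity on the asked points cancels one level at a time, whatever the siblings in `w`
and `w'` are. -/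
theorem leaf_eq_of_pathHash_eq
    (henc : Function.Injective fun x : V × R => encV x.1 ++ encR x.2) {H : Oracle κ}
    {S : Set (List Bool)} (hS : Set.InjOn H S) {i j : ℕ} {v v' : V} {r r' : R}
    {w w' : Fin d → Hash κ} {n : ℕ} (hn : n ≤ d)
    (h1 : ∀ x ∈ (pathStrategy i (leafStrategy κ encV encR d j v r) w n hn).asked H, x ∈ S)
    (h2 : ∀ x ∈ (pathStrategy i (leafStrategy κ encV encR d j v' r') w' n hn).asked H, x ∈ S)
    (heq : pathHash H i (leafHash encV encR H d j v r) w n hn =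
      pathHash H i (leafHash encV encR H d j v' r') w' n hn) : v = v' ∧ r = r' := by
  induction n with
  | zero =>
    simp only [pathStrategy, leafStrategy, Interaction.asked, List.mem_singleton,
      forall_eq] at h1 h2
    exact leaf_inj henc (hS h1 h2 heq)
  | succ n ih =>
    simp only [pathStrategy, Interaction.asked_bind, List.mem_append, run_pathStrategy] at h1 h2
    refine ih _ (fun x hx => h1 x (Or.inl hx)) (fun x hx => h2 x (Or.inl hx)) ?_
    simp only [pathHash] at heq
    split_ifs at heq h1 h2
    · simp only [interiorStrategy, Interaction.asked, List.mem_singleton] at h1 h2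
      exact (append_ofFn_inj (hS (h1 _ (Or.inr rfl)) (h2 _ (Or.inr rfl)) heq)).1
    · simp only [interiorStrategy, Interaction.asked, List.mem_singleton] at h1 h2
      exact (append_ofFn_inj (hS (h1 _ (Or.inr rfl)) (h2 _ (Or.inr rfl)) heq)).2

theorem injOn_of_no_collision {H : Oracle κ} {l : List (List Bool)}
    (h : ¬ ∃ x ∈ l, ∃ y ∈ l, x ≠ y ∧ H x = H y) : Set.InjOn H {x | x ∈ l} := by
  intro x hx y hy hxy
  by_contra hne
  exact h ⟨x, hx, y, hy, hne, hxy⟩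

theorem merkleVC_bindingProb_le
    (henc : Function.Injective fun x : V × R => encV x.1 ++ encR x.2) (q : ℕ)
    (A : PMF (merkleVC κ d encV encR).BindingStrategy)
    (hA : ∀ a ∈ A.support, ∀ H : Oracle κ, (a.asked H).length ≤ q) :
    (merkleVC κ d encV encR).bindingProb A
      ≤ ((q : ℝ) + 2 * (2 ^ (d + 1) - 1)) ^ 2 / 2 ^ κ := by
  refine romProb_le (by positivity) fun a ha => ?_
  -- The adversary followed by both commitment computations; only its questions matter, its output
  -- is discarded.
  let s : OracleStrategy κ (Hash κ) := a.bind fun o =>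
    (nodeStrategy κ encV encR o.1 o.2.2.1 d 0).bind fun _ =>
      nodeStrategy κ encV encR o.2.1 o.2.2.2 d 0
  have hlen : ∀ H, (s.asked H).length ≤ q + 2 * (2 ^ (d + 1) - 1) := by
    intro H
    have h0 := hA a ha H
    have h1 := length_asked_nodeStrategy (encV := encV) (encR := encR) H
      (a.run H).1 (a.run H).2.2.1 d 0
    have h2 := length_asked_nodeStrategy (encV := encV) (encR := encR) H
      (a.run H).2.1 (a.run H).2.2.2 d 0
    simp only [s, Interaction.asked_bind, List.length_append]
    omega
  have hle := oracleLaw_collision_le s hlen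
  -- The natural subtraction does not truncate, since `1 ≤ 2 ^ (d + 1)`.
  have hcast : ((q + 2 * (2 ^ (d + 1) - 1) : ℕ) : ℝ) = (q : ℝ) + 2 * (2 ^ (d + 1) - 1) := by
    rw [Nat.cast_add, Nat.cast_mul, Nat.cast_sub Nat.one_le_two_pow]
    push_cast
    ring
  rw [hcast] at hle
  refine (MeasureTheory.measure_mono fun H hH => ?_).trans hle
  by_contra hc
  obtain ⟨hne, heq⟩ : ((a.run H).1 ≠ (a.run H).2.1 ∨ (a.run H).2.2.1 ≠ (a.run H).2.2.2) ∧ _ := hH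
  have hS := injOn_of_no_collision hc
  have hsub : ∀ x, x ∈ (nodeStrategy κ encV encR (a.run H).1 (a.run H).2.2.1 d 0).asked H ∨
      x ∈ (nodeStrategy κ encV encR (a.run H).2.1 (a.run H).2.2.2 d 0).asked H →
      x ∈ s.asked H := by
    intro x hx
    simp only [s, Interaction.asked_bind, List.mem_append]
    exact Or.inr hx
  have hall := leaves_eq_of_nodeHash_eq henc hS (fun x hx => hsub x (Or.inl hx))
    (fun x hx => hsub x (Or.inr hx)) heq
  have h0 : ∀ m : Fin (2 ^ d), (m : ℕ) / 2 ^ d = 0 := fun m => Nat.div_eq_of_lt m.2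
  exact hne.elim (fun h => h (funext fun m => (hall m (h0 m)).1))
    fun h => h (funext fun m => (hall m (h0 m)).2)

theorem merkleVC_positionProb_le
    (henc : Function.Injective fun x : V × R => encV x.1 ++ encR x.2) (q : ℕ)
    (A : PMF (merkleVC κ d encV encR).PositionStrategy)
    (hA : ∀ a ∈ A.support, ∀ H : Oracle κ, (a.asked H).length ≤ q) :
    (merkleVC κ d encV encR).positionProb A ≤ ((q : ℝ) + 2 * (d + 1)) ^ 2 / 2 ^ κ := by
  refine romProb_le (by positivity) fun a ha => ?_
  let s : OracleStrategy κ (Hash κ) := a.bind fun ⟨_, i, v, v', r, r', w, w'⟩ =>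
    (pathStrategy i (leafStrategy κ encV encR d i v r) w d le_rfl).bind fun _ =>
      pathStrategy i (leafStrategy κ encV encR d i v' r') w' d le_rfl
  have hlen : ∀ H, (s.asked H).length ≤ q + 2 * (d + 1) := by
    intro H
    have h0 := hA a ha H
    simp only [s, Interaction.asked_bind, List.length_append]
    obtain ⟨C, i, v, v', r, r', w, w'⟩ := a.run H
    have h1 := length_asked_pathStrategy H i (leafStrategy κ encV encR d i v r) w d le_rfl
    have h2 := length_asked_pathStrategy H i (leafStrategy κ encV encR d i v' r') w' d le_rfl
    have h3 : ∀ v r, ((leafStrategy κ encV encR d i v r).asked H).length = 1 := fun _ _ => rfl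
    rw [h3] at h1 h2
    exact (Nat.add_le_add h0 (Nat.add_le_add h1.le h2.le)).trans (by omega)
  have hle := oracleLaw_collision_le s hlen
  have hcast : ((q + 2 * (d + 1) : ℕ) : ℝ) = (q : ℝ) + 2 * (d + 1) := by push_cast; ring
  rw [hcast] at hle
  refine (MeasureTheory.measure_mono fun H hH => ?_).trans hle
  by_contra hc
  have hS := injOn_of_no_collision hc
  simp only [Set.mem_ofPred_eq, VCScheme.PositionWin] at hH
  simp only [s, Interaction.asked_bind, List.mem_append] at hS
  obtain ⟨C, i, v, v', r, r', w, w'⟩ := a.run H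
  simp only [merkleVC, decide_eq_true_eq] at hH
  obtain ⟨hne, h1, h2⟩ := hH
  have := leaf_eq_of_pathHash_eq henc hS le_rfl (fun x hx => Or.inr (Or.inl hx))
    (fun x hx => Or.inr (Or.inr hx)) (h1.trans h2.symm)
  exact hne.elim (fun h => h this.1) fun h => h this.2

end Merkle

/-! ### Negligible functions -/

theorem tendsto_polynomial_div_two_pow (P : Polynomial ℝ) :
    Filter.Tendsto (fun n : ℕ => P.eval (n : ℝ) / 2 ^ n) Filter.atTop (nhds 0) := by
  induction P using Polynomial.induction_on' with
  | add p q hp hq => simpa [add_div] using hp.add hq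
  | monomial k a =>
    have := (tendsto_pow_const_mul_const_pow_of_abs_lt_one k
      (r := (1 / 2 : ℝ)) (by norm_num [abs_of_pos])).const_mul a
    rw [mul_zero] at this
    refine this.congr fun n => ?_
    simp only [Polynomial.eval_monomial, one_div, inv_pow]
    ring

theorem negligible_of_le_polynomial_div {f : ℕ → ℝ} (P : Polynomial ℝ)
    (h : ∀ n, f n ≤ P.eval (n : ℝ) / 2 ^ n) : Negligible f := by
  intro c hc
  obtain ⟨m, hm⟩ := exists_nat_ge c
  have ht := (tendsto_polynomial_div_two_pow (P * Polynomial.X ^ m)).eventually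
    (gt_mem_nhds (zero_lt_one' ℝ))
  obtain ⟨n₀, hn₀⟩ := Filter.eventually_atTop.1 ht
  -- From `n ≥ 1` on, powers of `n` increase with the exponent, so the real `c` may be replaced by
  -- the natural number `m ≥ c`.
  refine ⟨max n₀ 1, fun n hn => ?_⟩
  have h1 : (1 : ℝ) ≤ n := by exact_mod_cast (le_max_right _ _).trans hn
  have hpos : (0 : ℝ) < (n : ℝ) ^ m := by positivity
  have h2 := hn₀ n ((le_max_left _ _).trans hn)
  simp only [Polynomial.eval_mul, Polynomial.eval_pow, Polynomial.eval_X] at h2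
  calc f n ≤ P.eval (n : ℝ) / 2 ^ n := h n
    _ < 1 / (n : ℝ) ^ m := by
      rw [lt_div_iff₀ hpos]
      calc _ = P.eval (n : ℝ) * (n : ℝ) ^ m / 2 ^ n := by ring
        _ < 1 := h2
    _ ≤ 1 / (n : ℝ) ^ c := by
      refine one_div_le_one_div_of_le (by positivity) ?_
      rw [← Real.rpow_natCast]
      exact Real.rpow_le_rpow_of_exponent_le h1 hm

/-! ### Dependence on finitely many values of the oracle -/

section FiniteDependence

variable {κ : ℕ} {β γ : Type}

/-- `f H` depends on finitely many values of `H` only. -/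
def DependsOnFinite (f : Oracle κ → β) : Prop :=
  ∃ F : Finset (List Bool), DependsOn f (F : Set (List Bool))

theorem dependsOnFinite_const (c : β) : DependsOnFinite fun _ : Oracle κ => c :=
  ⟨∅, fun _ _ _ => rfl⟩

theorem dependsOnFinite_eval (x : List Bool) : DependsOnFinite fun H : Oracle κ => H x :=
  ⟨{x}, fun _ _ h => h x (by simp)⟩

theorem DependsOnFinite.pi {ι : Type} [Finite ι] {δ : ι → Type} {f : ∀ i, Oracle κ → δ i}
    (hf : ∀ i, DependsOnFinite (f i)) : DependsOnFinite fun H i => f i H := by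
  classical
  cases nonempty_fintype ι
  choose F hF using hf
  refine ⟨Finset.univ.biUnion F, fun H H' h => funext fun i => hF i fun x hx => h x ?_⟩
  simp only [Finset.coe_biUnion, Set.mem_iUnion]
  exact ⟨i, by simp, hx⟩

/-- The intermediate value ranges over a finite type, so the dependence sets of all possible
continuations have a finite union. -/
theorem DependsOnFinite.bind [Finite γ] {f : Oracle κ → γ} {g : γ → Oracle κ → β}
    (hf : DependsOnFinite f) (hg : ∀ c, DependsOnFinite (g c)) :
    DependsOnFinite fun H => g (f H) H := by
  classical
  obtain ⟨F, hF⟩ := hf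
  obtain ⟨G, hG⟩ := DependsOnFinite.pi hg
  refine ⟨F ∪ G, fun H H' h => ?_⟩
  have h1 : f H = f H' := hF fun x hx => h x (by simp [Finset.mem_coe.1 hx])
  have h2 := congrFun (hG fun x hx => h x (by simp [Finset.mem_coe.1 hx])) (f H)
  simpa only [← h1] using h2

theorem DependsOnFinite.comp {f : Oracle κ → γ} (hf : DependsOnFinite f) (g : γ → β) :
    DependsOnFinite fun H => g (f H) := by
  obtain ⟨F, hF⟩ := hf
  exact ⟨F, fun H H' h => congrArg g (hF h)⟩

/-- Only the answers need to be finite, not the output type `α`: in the hiding game the first phase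
outputs a whole continuation strategy. -/
theorem DependsOnFinite.run {Q α : Type} {Ans : Q → Type} [∀ q, Finite (Ans q)]
    {answer : Oracle κ → ∀ q, Ans q} (h : ∀ q, DependsOnFinite fun H => answer H q)
    {g : α → Oracle κ → β} (hg : ∀ c, DependsOnFinite (g c)) (s : Interaction Q Ans α) :
    DependsOnFinite fun H => g (s.run (answer H)) H := by
  induction s with
  | done a => exact hg a
  | ask q next ih => exact (h q).bind ih

theorem dependsOnFinite_nodeHash (d : ℕ) {leaf : Oracle κ → ℕ → Hash κ}
    (h : ∀ j, DependsOnFinite fun H => leaf H j) (n j : ℕ) :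
    DependsOnFinite fun H => nodeHash H d (leaf H) n j := by
  induction n generalizing j with
  | zero => exact h j
  | succ n ih =>
    exact (ih (2 * j)).bind
      (g := fun h₀ H => interiorHash H d (n + 1) j h₀ (nodeHash H d (leaf H) n (2 * j + 1)))
      fun h₀ => (ih (2 * j + 1)).bind (g := fun h₁ H => interiorHash H d (n + 1) j h₀ h₁)
        fun h₁ => dependsOnFinite_eval _

end FiniteDependence

/-! ### Identifiers of nodes -/

/-- The code is prefix-free: the first bit separates the star from the binary digits. -/
theorem flatMap_symbolBits_injective :
    Function.Injective fun l : List (Option Bool) => l.flatMap symbolBits := by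
  intro l l' h
  induction l generalizing l' with
  | nil =>
    match l' with
    | [] => rfl
    | none :: _ => simp [symbolBits] at h
    | some _ :: _ => simp [symbolBits] at h
  | cons a l ih =>
    match a, l' with
    | none, [] => simp [symbolBits] at h
    | some _, [] => simp [symbolBits] at h
    | none, none :: l' => simp only [List.flatMap_cons, symbolBits, List.cons_append,
        List.nil_append, List.cons.injEq, true_and] at h; rw [ih h]
    | none, some _ :: _ => simp [symbolBits] at h
    | some _, none :: _ => simp [symbolBits] at h
    | some b, some b' :: l' =>
      simp only [List.flatMap_cons, symbolBits, List.cons_append, List.nil_append,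
        List.cons.injEq, true_and] at h
      rw [h.1, ih h.2]

theorem length_nodeBits (d n j : ℕ) : (nodeBits d n j).length = d * 2 := by
  have h : ∀ l : List (Option Bool), (l.flatMap symbolBits).length = l.length * 2 := by
    intro l
    induction l with
    | nil => rfl
    | cons a l ih => cases a <;> simp [symbolBits, ih] <;> ring
  rw [nodeBits, h, nodeId, List.length_ofFn]

theorem nodeId_eq_of_nodeBits_eq {d n j n' j' : ℕ} (h : nodeBits d n j = nodeBits d n' j') :
    nodeId d n j = nodeId d n' j' :=
  flatMap_symbolBits_injective h

theorem nodeBits_zero_injective {d i j : ℕ} (hi : i < 2 ^ d) (hj : j < 2 ^ d)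
    (h : nodeBits d 0 i = nodeBits d 0 j) : i = j := by
  have h := List.ofFn_injective (nodeId_eq_of_nodeBits_eq h)
  refine Nat.eq_of_testBit_eq fun t => ?_
  by_cases ht : t < d
  · have := congrFun h ⟨d - 1 - t, by omega⟩
    simpa [show d - 1 - (d - 1 - t) = t by omega] using this
  · have : 2 ^ d ≤ 2 ^ t := Nat.pow_le_pow_right (by norm_num) (by omega)
    rw [Nat.testBit_lt_two_pow (hi.trans_le this), Nat.testBit_lt_two_pow (hj.trans_le this)]

/-- The last symbol is a star exactly when the height is positive. -/
theorem nodeBits_zero_ne_succ {d i n j : ℕ} (hn : n + 1 ≤ d) :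
    nodeBits d 0 i ≠ nodeBits d (n + 1) j := by
  intro h
  have h := congrFun (List.ofFn_injective (nodeId_eq_of_nodeBits_eq h)) ⟨d - 1, by omega⟩
  simp at h

/-! ### Relabelling the leaf points of the oracle -/

section Relabel

variable {κ : ℕ} {T : Type} {p : T → List Bool} {τ : T → T}

/-- The oracle whose value at `p t` is the value of `H` at `p (τ t)`. -/
noncomputable def relabel (p : T → List Bool) (τ : T → T) (H : Oracle κ) : Oracle κ :=
  Function.extend p (fun t => H (p (τ t))) H

theorem relabel_apply (hp : Function.Injective p) (H : Oracle κ) (t : T) :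
    relabel p τ H (p t) = H (p (τ t)) :=
  hp.extend_apply _ _ _

theorem relabel_of_forall_ne (H : Oracle κ) {x : List Bool} (hx : ∀ t, p t ≠ x) :
    relabel p τ H x = H x :=
  Function.extend_apply' _ _ _ fun ⟨t, ht⟩ => hx t ht

theorem relabel_of_fixed (hp : Function.Injective p) (H : Oracle κ) {x : List Bool}
    (hx : ∀ t, p t = x → τ t = t) : relabel p τ H x = H x := by
  by_cases h : ∃ t, p t = x
  · obtain ⟨t, rfl⟩ := h
    rw [relabel_apply hp, hx t rfl]
  · exact relabel_of_forall_ne H fun t ht => h ⟨t, ht⟩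

theorem relabel_relabel (hp : Function.Injective p) (hτ : Function.Involutive τ)
    (H : Oracle κ) : relabel p τ (relabel p τ H) = H := by
  funext x
  by_cases h : ∃ t, p t = x
  · obtain ⟨t, rfl⟩ := h
    rw [relabel_apply hp, relabel_apply hp, hτ]
  · have h : ∀ t, p t ≠ x := fun t ht => h ⟨t, ht⟩
    rw [relabel_of_forall_ne _ h, relabel_of_forall_ne _ h]

theorem relabel_mem_tables {F : Finset (List Bool)} (hF : ∀ t, p t ∈ F) {H : Oracle κ}
    (hH : H ∈ tables κ F) : relabel p τ H ∈ tables κ F :=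
  mem_tables.2 fun x hx => by
    have h : ∀ t, p t ≠ x := fun t ht => hx (ht ▸ hF t)
    rw [relabel_of_forall_ne _ h, mem_tables.1 hH x hx]

end Relabel

/-! ### Leaf points and the tree under relabelling -/

section LeafPoints

variable {κ d : ℕ} {V R : Type} {encV : V → List Bool} {encR : R → List Bool}

/-- The point at which the oracle is evaluated for the hash of a leaf. -/
def leafPoint (d : ℕ) (encV : V → List Bool) (encR : R → List Bool)
    (t : Fin (2 ^ d) × V × R) : List Bool :=
  nodeBits d 0 t.1 ++ encV t.2.1 ++ encR t.2.2

theorem leafPoint_injective (henc : Function.Injective fun x : V × R => encV x.1 ++ encR x.2) :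
    Function.Injective (leafPoint d encV encR) := by
  rintro ⟨i, v, r⟩ ⟨i', v', r'⟩ h
  simp only [leafPoint, List.append_assoc] at h
  obtain ⟨h1, h2⟩ := List.append_inj h (by rw [length_nodeBits, length_nodeBits])
  obtain rfl := Fin.ext (nodeBits_zero_injective i.2 i'.2 h1)
  rw [henc (a₁ := (v, r)) (a₂ := (v', r')) h2]

/-- Domain separation: identifiers have a fixed length, so equal inputs would have equal
identifiers. Hence relabelling leaf points leaves the interior hash evaluations intact. -/
theorem leafPoint_ne_interior {n j : ℕ} (hn : n + 1 ≤ d) (h₀ h₁ : Hash κ)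
    (t : Fin (2 ^ d) × V × R) :
    leafPoint d encV encR t ≠ nodeBits d (n + 1) j ++ List.ofFn h₀ ++ List.ofFn h₁ := by
  intro h
  simp only [leafPoint, List.append_assoc] at h
  exact nodeBits_zero_ne_succ hn
    (List.append_inj h (by rw [length_nodeBits, length_nodeBits])).1

theorem interiorHash_relabel (τ : Fin (2 ^ d) × V × R → Fin (2 ^ d) × V × R) (H : Oracle κ)
    {n : ℕ} (hn : n + 1 ≤ d) (j : ℕ) (h₀ h₁ : Hash κ) :
    interiorHash (relabel (leafPoint d encV encR) τ H) d (n + 1) j h₀ h₁ =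
      interiorHash H d (n + 1) j h₀ h₁ :=
  relabel_of_forall_ne _ fun t => leafPoint_ne_interior hn h₀ h₁ t

theorem nodeHash_relabel (τ : Fin (2 ^ d) × V × R → Fin (2 ^ d) × V × R) (H : Oracle κ)
    {leaf leaf' : ℕ → Hash κ} (hleaf : ∀ j, leaf' j = leaf j) {n : ℕ} (hn : n ≤ d) (j : ℕ) :
    nodeHash (relabel (leafPoint d encV encR) τ H) d leaf' n j = nodeHash H d leaf n j := by
  induction n generalizing j with
  | zero => exact hleaf j
  | succ n ih =>
    simp only [nodeHash, interiorHash_relabel τ H hn, ih (Nat.le_of_succ_le hn)]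

theorem leafHashes_relabel (henc : Function.Injective fun x : V × R => encV x.1 ++ encR x.2)
    {τ : Fin (2 ^ d) × V × R → Fin (2 ^ d) × V × R} (H : Oracle κ)
    {v v' : Fin (2 ^ d) → V} {r r' : Fin (2 ^ d) → R}
    (hτ : ∀ i, τ (i, v' i, r' i) = (i, v i, r i)) (j : ℕ) :
    leafHashes encV encR (relabel (leafPoint d encV encR) τ H) v' r' j =
      leafHashes encV encR H v r j := by
  unfold leafHashes
  split_ifs with h
  · exact (relabel_apply (leafPoint_injective henc) H (⟨j, h⟩, v' ⟨j, h⟩, r' ⟨j, h⟩)).trans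
      (by rw [hτ]; rfl)
  · rfl

end LeafPoints

/-! ### The view of the adversary in the hiding game -/

section View

variable {κ d : ℕ} {V R : Type} {encV : V → List Bool} {encR : R → List Bool}

/-- The points of the leaves at which the two vectors differ, with the given salts. -/
def IsSecret (encV : V → List Bool) (encR : R → List Bool) (vs : Bool → Fin (2 ^ d) → V)
    (r : Fin (2 ^ d) → R) (x : List Bool) : Prop :=
  ∃ i v, vs false i ≠ vs true i ∧ x = leafPoint d encV encR (i, v, r i)

theorem IsSecret.congr {vs : Bool → Fin (2 ^ d) → V} {r r' : Fin (2 ^ d) → R}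
    (h : ∀ i, vs false i ≠ vs true i → r i = r' i) {x : List Bool}
    (hx : IsSecret encV encR vs r x) : IsSecret encV encR vs r' x := by
  obtain ⟨i, v, hi, rfl⟩ := hx
  exact ⟨i, v, hi, by rw [h i hi]⟩

variable (a : (merkleVC κ d encV encR).HidingStrategy)

/-- In the first phase, the adversary asks for a secret point for the salts `ρ`. -/
def AsksFirst (H : Oracle κ) (ρ : Fin (2 ^ d) → R) : Prop :=
  ∃ x ∈ a.asked H, IsSecret encV encR (a.run H).1 ρ x

/-- In the second phase, the adversary asks for a secret point for the salts `ρ`. -/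
def AsksSecond (H : Oracle κ) (b : Bool) (r ρ : Fin (2 ^ d) → R) : Prop :=
  ∃ x, .inl x ∈ (merkleVC κ d encV encR).guessAsked H a b r ∧
    IsSecret encV encR (a.run H).1 ρ x

/-- Outside of the points in `P`, the games with `H, b, r` and `H', b', r'` look the same. -/
structure SameView (P : List Bool → Prop) (H H' : Oracle κ) (b b' : Bool)
    (r r' : Fin (2 ^ d) → R) : Prop where
  oracle : ∀ x, ¬ P x → H x = H' x
  commit : (merkleVC κ d encV encR).commit H ((a.run H).1 b) r =
    (merkleVC κ d encV encR).commit H' ((a.run H).1 b') r'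
  opening : ∀ i, (merkleVC κ d encV encR).guessAnswer H (a.run H).1 b r (.inr i) =
    (merkleVC κ d encV encR).guessAnswer H' (a.run H).1 b' r' (.inr i)

variable {a} {P : List Bool → Prop} {H H' : Oracle κ} {b b' : Bool} {r r' : Fin (2 ^ d) → R}

theorem hidingGuess_eq (S : VCScheme κ (2 ^ d) V R) (H : Oracle κ) (a : S.HidingStrategy)
    (b : Bool) (r : Fin (2 ^ d) → R) : S.hidingGuess H a b r =
      ((a.run H).2 (S.commit H ((a.run H).1 b) r)).run (S.guessAnswer H (a.run H).1 b r) :=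
  rfl

theorem guessAsked_eq (S : VCScheme κ (2 ^ d) V R) (H : Oracle κ) (a : S.HidingStrategy)
    (b : Bool) (r : Fin (2 ^ d) → R) : S.guessAsked H a b r =
      ((a.run H).2 (S.commit H ((a.run H).1 b) r)).asked (S.guessAnswer H (a.run H).1 b r) :=
  rfl

theorem SameView.first (h : SameView a P H H' b b' r r') (hP : ∀ x ∈ a.asked H, ¬ P x) :
    a.run H = a.run H' ∧ a.asked H = a.asked H' :=
  Interaction.run_asked_congr a fun x hx => h.oracle x (hP x hx)

theorem SameView.answer (h : SameView a P H H' b b' r r') (q : List Bool ⊕ Fin (2 ^ d))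
    (hq : ¬ Sum.elim P (fun _ => False) q) :
    (merkleVC κ d encV encR).guessAnswer H (a.run H).1 b r q =
      (merkleVC κ d encV encR).guessAnswer H' (a.run H).1 b' r' q := by
  cases q with
  | inl x => exact h.oracle x hq
  | inr i => exact h.opening i

theorem SameView.second (h : SameView a P H H' b b' r r') (hP : ∀ x ∈ a.asked H, ¬ P x)
    (hP' : ∀ x, .inl x ∈ (merkleVC κ d encV encR).guessAsked H a b r → ¬ P x) :
    (merkleVC κ d encV encR).hidingGuess H a b r =
      (merkleVC κ d encV encR).hidingGuess H' a b' r' ∧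
    (merkleVC κ d encV encR).guessAsked H a b r =
      (merkleVC κ d encV encR).guessAsked H' a b' r' := by
  have h1 := (h.first hP).1
  have h2 := Interaction.run_asked_congr
    ((a.run H).2 ((merkleVC κ d encV encR).commit H ((a.run H).1 b) r))
    (f := (merkleVC κ d encV encR).guessAnswer H (a.run H).1 b r)
    (g := (merkleVC κ d encV encR).guessAnswer H' (a.run H).1 b' r') (fun q hq =>
      h.answer q (by
        cases q with
        | inl x => exact hP' x hq
        | inr i => exact id))
  rw [hidingGuess_eq, hidingGuess_eq, guessAsked_eq, guessAsked_eq, ← h1, ← h.commit]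
  exact h2

/-- The two runs stay identical until a question in `P` occurs, and the first such question is still
common to both. -/
theorem SameView.exists_common (h : SameView a P H H' b b' r r')
    (hP : ∀ x ∈ a.asked H, ¬ P x)
    (hP' : ∃ x, .inl x ∈ (merkleVC κ d encV encR).guessAsked H a b r ∧ P x) :
    ∃ x, .inl x ∈ (merkleVC κ d encV encR).guessAsked H a b r ∧
      .inl x ∈ (merkleVC κ d encV encR).guessAsked H' a b' r' ∧ P x := by
  have h1 := (h.first hP).1
  obtain ⟨x, hx, hPx⟩ := hP'
  obtain ⟨q, h2, h3, h4⟩ := Interaction.exists_common_asked h.answer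
    ((a.run H).2 ((merkleVC κ d encV encR).commit H ((a.run H).1 b) r)) ⟨.inl x, hx, hPx⟩
  cases q with
  | inr i => exact h4.elim
  | inl y =>
    refine ⟨y, h2, ?_, h4⟩
    rw [guessAsked_eq, ← h1, ← h.commit]
    exact h3

/-- By `hτ` the new leaf inputs get the old leaf hashes, so the whole tree is unchanged, and with it
the commitment and all sibling hashes. The salts that may be revealed agree by `hr`, and the oracles
differ only at points moved by `τ`. -/
theorem sameView_relabel (henc : Function.Injective fun x : V × R => encV x.1 ++ encR x.2)
    {τ : Fin (2 ^ d) × V × R → Fin (2 ^ d) × V × R}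
    (hP : ∀ t, τ t ≠ t → P (leafPoint d encV encR t))
    (hτ : ∀ i, τ (i, (a.run H).1 b' i, r' i) = (i, (a.run H).1 b i, r i))
    (hr : ∀ i, (a.run H).1 false i = (a.run H).1 true i → r' i = r i) :
    SameView a P H (relabel (leafPoint d encV encR) τ H) b b' r r' where
  oracle x hx := by
    refine (relabel_of_fixed (leafPoint_injective henc) H ?_).symm
    rintro t rfl
    by_contra ht
    exact hx (hP t ht)
  commit := (nodeHash_relabel τ H (leafHashes_relabel henc H hτ) le_rfl 0).symm
  opening i := by
    simp only [VCScheme.guessAnswer]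
    split_ifs with hi
    · rw [hr i hi]
      congr 2
      funext n
      exact (nodeHash_relabel τ H (leafHashes_relabel henc H hτ) n.2.le _).symm
    · rfl

end View

/-! ### Exchanging values and salts -/

section Exchange

open Classical in
/-- Exchange the two values of each leaf, for the salts `r`. -/
noncomputable def swapValues {ι V R : Type} (vs : Bool → ι → V) (r : ι → R)
    (t : ι × V × R) : ι × V × R :=
  if t.2.2 = r t.1 then (t.1, Equiv.swap (vs false t.1) (vs true t.1) t.2.1, t.2.2) else t

open Classical in
/-- Exchange the salts in `r` and `ρ` of each leaf at which the two vectors differ. -/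
noncomputable def swapSalts {ι V R : Type} (vs : Bool → ι → V) (r ρ : ι → R)
    (t : ι × V × R) : ι × V × R :=
  if vs false t.1 ≠ vs true t.1 then (t.1, t.2.1, Equiv.swap (r t.1) (ρ t.1) t.2.2) else t

open Classical in
/-- Replace `r` by `ρ` at the leaves at which the two vectors differ. -/
noncomputable def mixSalts {ι V R : Type} (vs : Bool → ι → V) (r ρ : ι → R) (i : ι) : R :=
  if vs false i ≠ vs true i then ρ i else r i

variable {ι V R : Type} (vs : Bool → ι → V) (r ρ : ι → R)

theorem swapValues_involutive : Function.Involutive (swapValues vs r) := by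
  rintro ⟨i, v, s⟩
  by_cases h : s = r i <;> simp [swapValues, h]

theorem swapSalts_involutive : Function.Involutive (swapSalts vs r ρ) := by
  rintro ⟨i, v, s⟩
  by_cases h : vs false i = vs true i <;> simp [swapSalts, h]

theorem mixSalts_of_ne {i : ι} (h : vs false i ≠ vs true i) : mixSalts vs r ρ i = ρ i :=
  if_pos h

theorem mixSalts_of_eq {i : ι} (h : vs false i = vs true i) : mixSalts vs r ρ i = r i :=
  if_neg (not_not.2 h)

/-- Thus the exchange of `(r, ρ)` at the differing leaves is an involution. The other leaves keep
their salts, because openings may reveal them. -/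
theorem mixSalts_mixSalts : mixSalts vs (mixSalts vs r ρ) (mixSalts vs ρ r) = r := by
  funext i
  by_cases h : vs false i = vs true i <;> simp [mixSalts, h]

end Exchange

/-! ### Counting samples in the hiding game -/

section Counting

variable {κ d : ℕ} {V R : Type} {encV : V → List Bool} {encR : R → List Bool}
  {a : (merkleVC κ d encV encR).HidingStrategy}

theorem sameView_swapValues (henc : Function.Injective fun x : V × R => encV x.1 ++ encR x.2)
    (H : Oracle κ) (b : Bool) (r : Fin (2 ^ d) → R) :
    SameView a (IsSecret encV encR (a.run H).1 r) H
      (relabel (leafPoint d encV encR) (swapValues (a.run H).1 r) H) b (!b) r r := by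
  refine sameView_relabel henc ?_ ?_ fun _ _ => rfl
  · rintro ⟨i, v, s⟩ ht
    by_cases hs : s = r i
    · subst hs
      refine ⟨i, v, fun h => ht ?_, rfl⟩
      simp [swapValues, h]
    · exact absurd (by simp [swapValues, hs]) ht
  · intro i
    cases b <;> simp [swapValues]

theorem sameView_swapSalts (henc : Function.Injective fun x : V × R => encV x.1 ++ encR x.2)
    (H : Oracle κ) (b : Bool) (r ρ : Fin (2 ^ d) → R) :
    SameView a
      (fun x => IsSecret encV encR (a.run H).1 r x ∨ IsSecret encV encR (a.run H).1 ρ x) H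
      (relabel (leafPoint d encV encR) (swapSalts (a.run H).1 r ρ) H) b b r
      (mixSalts (a.run H).1 r ρ) := by
  classical
  refine sameView_relabel henc ?_ ?_ fun i hi => mixSalts_of_eq _ _ _ hi
  · rintro ⟨i, v, s⟩ ht
    by_cases hi : (a.run H).1 false i = (a.run H).1 true i
    · exact absurd (by simp [swapSalts, hi]) ht
    · by_cases h1 : s = r i
      · exact Or.inl ⟨i, v, hi, by rw [h1]⟩
      · by_cases h2 : s = ρ i
        · exact Or.inr ⟨i, v, hi, by rw [h2]⟩
        · exact absurd (by simp [swapSalts, Equiv.swap_apply_of_ne_of_ne h1 h2]) ht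
  · intro i
    by_cases hi : (a.run H).1 false i = (a.run H).1 true i <;>
      simp [swapSalts, mixSalts, hi]

variable [Fintype R]

/-- The randomness of the challenger, with an oracle that vanishes outside of `F`. -/
noncomputable def sampleSpace (κ d : ℕ) (R : Type) [Fintype R] (F : Finset (List Bool)) :
    Finset (Oracle κ × Bool × (Fin (2 ^ d) → R)) :=
  open Classical in tables κ F ×ˢ Finset.univ

/-- The adversary asks for a secret point for the salts `ρ`. -/
def AsksSecret (a : (merkleVC κ d encV encR).HidingStrategy)
    (z : Oracle κ × Bool × (Fin (2 ^ d) → R)) (ρ : Fin (2 ^ d) → R) : Prop :=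
  AsksFirst a z.1 ρ ∨ AsksSecond a z.1 z.2.1 z.2.2 ρ

-- Exchanging the values and flipping `b` preserves the guess, hence turns a win into a loss and
-- conversely. Used for both values of `o`, it gives equality.
open Classical in
theorem card_win_le (henc : Function.Injective fun x : V × R => encV x.1 ++ encR x.2)
    {F : Finset (List Bool)} (hF : ∀ t, leafPoint d encV encR t ∈ F) (o : Bool) :
    ((sampleSpace κ d R F).filter fun z => ¬ AsksSecret a z z.2.2 ∧
      ((merkleVC κ d encV encR).hidingGuess z.1 a z.2.1 z.2.2 ^^ z.2.1) = o).card ≤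
    ((sampleSpace κ d R F).filter fun z => ¬ AsksSecret a z z.2.2 ∧
      ((merkleVC κ d encV encR).hidingGuess z.1 a z.2.1 z.2.2 ^^ z.2.1) = !o).card := by
  have key : ∀ (H : Oracle κ) (b : Bool) (r : Fin (2 ^ d) → R), ¬ AsksSecret a (H, b, r) r →
      let H' := relabel (leafPoint d encV encR) (swapValues (a.run H).1 r) H
      a.run H = a.run H' ∧ ¬ AsksSecret a (H', !b, r) r ∧
        (merkleVC κ d encV encR).hidingGuess H a b r =
          (merkleVC κ d encV encR).hidingGuess H' a (!b) r := by
    intro H b r hn H'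
    have hv := sameView_swapValues (a := a) henc H b r
    have hn1 : ∀ x ∈ a.asked H, ¬ IsSecret encV encR (a.run H).1 r x :=
      fun x hx hs => hn (Or.inl ⟨x, hx, hs⟩)
    have h1 := hv.first hn1
    have h2 := hv.second hn1 fun x hx hs => hn (Or.inr ⟨x, hx, hs⟩)
    refine ⟨h1.1, ?_, h2.1⟩
    simp only [AsksSecret, AsksFirst, AsksSecond, H', ← h1.1, ← h1.2, ← h2.2]
    exact hn
  refine Finset.card_le_card_of_injOn (fun z =>
    (relabel (leafPoint d encV encR) (swapValues (a.run z.1).1 z.2.2) z.1, !z.2.1, z.2.2)) ?_ ?_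
  · rintro ⟨H, b, r⟩ hz
    simp only [Finset.coe_filter, Set.mem_ofPred_eq, sampleSpace, Finset.mem_product,
      Finset.mem_univ, and_true] at hz ⊢
    obtain ⟨hH, hn, ho⟩ := hz
    obtain ⟨h1, h2, h3⟩ := key H b r hn
    refine ⟨relabel_mem_tables hF hH, h2, ?_⟩
    rw [← h3, ← ho, Bool.xor_not]
  · rintro ⟨H, b, r⟩ hz ⟨H', b', r'⟩ hz' heq
    simp only [Finset.coe_filter, Set.mem_ofPred_eq] at hz hz'
    simp only [Prod.mk.injEq, Bool.not_inj_iff] at heq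
    obtain ⟨h1, rfl, rfl⟩ := heq
    -- The relabelling depends on the vectors chosen under `H`. They can be read off from the image
    -- because the first phase runs identically there, and then the involution can be undone.
    have hvs : a.run H = a.run H' := by
      rw [(key H b r hz.2.1).1, h1, ← (key H' b r hz'.2.1).1]
    have h4 := congrArg (relabel (leafPoint d encV encR) (swapValues (a.run H).1 r)) h1
    rw [hvs] at h4
    rw [relabel_relabel (leafPoint_injective henc) (swapValues_involutive _ _),
      relabel_relabel (leafPoint_injective henc) (swapValues_involutive _ _)] at h4
    rw [h4]

-- A leaf point determines its leaf `i` and its salt, so the condition pins the coordinate `ρ i` to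
-- one value of `R`.
open Classical in
theorem card_isSecret_mul_le (henc : Function.Injective fun x : V × R => encV x.1 ++ encR x.2)
    (vs : Bool → Fin (2 ^ d) → V) (x : List Bool) :
    ((Finset.univ : Finset (Fin (2 ^ d) → R)).filter fun ρ => IsSecret encV encR vs ρ x).card *
      Fintype.card R ≤ Fintype.card (Fin (2 ^ d) → R) := by
  by_cases h : ∃ t, leafPoint d encV encR t = x
  · obtain ⟨⟨i, v, s⟩, rfl⟩ := h
    have hs : ∀ ρ : Fin (2 ^ d) → R,
        IsSecret encV encR vs ρ (leafPoint d encV encR (i, v, s)) → ρ i = s := by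
      rintro ρ ⟨j, w, -, h⟩
      have := leafPoint_injective henc h
      simp only [Prod.mk.injEq] at this
      rw [this.2.2, this.1]
    rw [← Finset.card_univ (α := R), ← Finset.card_product, ← Finset.card_univ]
    refine Finset.card_le_card_of_injOn (fun p => Function.update p.1 i p.2)
      (fun _ _ => Finset.mem_coe.2 (Finset.mem_univ _)) ?_
    rintro ⟨ρ, u⟩ h ⟨ρ', u'⟩ h' heq
    have e := hs ρ (Finset.mem_filter.1 (Finset.mem_product.1 h).1).2
    have e' := hs ρ' (Finset.mem_filter.1 (Finset.mem_product.1 h').1).2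
    simp only at heq
    have hu : u = u' := by simpa using congrFun heq i
    have hρ : ρ = ρ' := by
      funext j
      by_cases hj : j = i
      · rw [hj, e, e']
      · simpa [Function.update_of_ne hj] using congrFun heq j
    rw [hu, hρ]
  · rw [Finset.filter_false_of_mem, Finset.card_empty, zero_mul]
    · exact Nat.zero_le _
    · rintro ρ - ⟨i, v, -, rfl⟩
      exact h ⟨_, rfl⟩

theorem length_filterMap_getLeft {α β : Type} (l : List (α ⊕ β)) :
    (l.filterMap Sum.getLeft?).length = l.countP Sum.isLeft := by
  induction l with
  | nil => rfl
  | cons x l ih => cases x <;> simp [List.countP_cons, List.filterMap_cons, ih]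

open Classical in
/-- Salts that are independent of the view of the adversary are hit with small probability. -/
theorem card_asksSecret_fiber_mul_le
    (henc : Function.Injective fun x : V × R => encV x.1 ++ encR x.2) {q : ℕ}
    (hq : ∀ H b r, (merkleVC κ d encV encR).hidingOracleQueries H a b r ≤ q)
    (z : Oracle κ × Bool × (Fin (2 ^ d) → R)) :
    ((Finset.univ : Finset (Fin (2 ^ d) → R)).filter (AsksSecret a z)).card * Fintype.card R ≤
      q * Fintype.card (Fin (2 ^ d) → R) := by
  let l := a.asked z.1 ++
    ((merkleVC κ d encV encR).guessAsked z.1 a z.2.1 z.2.2).filterMap Sum.getLeft?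
  have hl : l.length ≤ q := by
    refine le_trans (le_of_eq ?_) (hq z.1 z.2.1 z.2.2)
    simp only [l, List.length_append, length_filterMap_getLeft, VCScheme.hidingOracleQueries]
  have hsub : (Finset.univ : Finset (Fin (2 ^ d) → R)).filter (AsksSecret a z) ⊆
      l.toFinset.biUnion fun x => Finset.univ.filter fun ρ =>
        IsSecret encV encR (a.run z.1).1 ρ x := by
    intro ρ hρ
    simp only [Finset.mem_biUnion, Finset.mem_filter, Finset.mem_univ, true_and,
      List.mem_toFinset, l, List.mem_append, List.mem_filterMap]
    rcases (Finset.mem_filter.1 hρ).2 with ⟨x, hx, hs⟩ | ⟨x, hx, hs⟩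
    · exact ⟨x, Or.inl hx, hs⟩
    · exact ⟨x, Or.inr ⟨_, hx, rfl⟩, hs⟩
  calc _ ≤ (∑ x ∈ l.toFinset, ((Finset.univ : Finset (Fin (2 ^ d) → R)).filter fun ρ =>
        IsSecret encV encR (a.run z.1).1 ρ x).card) * Fintype.card R :=
        Nat.mul_le_mul_right _ ((Finset.card_le_card hsub).trans Finset.card_biUnion_le)
    _ ≤ ∑ x ∈ l.toFinset, Fintype.card (Fin (2 ^ d) → R) := by
        rw [Finset.sum_mul]
        exact Finset.sum_le_sum fun x _ => card_isSecret_mul_le henc _ x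
    _ ≤ q * Fintype.card (Fin (2 ^ d) → R) := by
        rw [Finset.sum_const, smul_eq_mul]
        exact Nat.mul_le_mul_right _ ((List.toFinset_card_le l).trans hl)

open Classical in
/-- The salts of the challenger are hit at most twice as often as independent salts. -/
theorem card_asksSecret_le (henc : Function.Injective fun x : V × R => encV x.1 ++ encR x.2)
    {F : Finset (List Bool)} (hF : ∀ t, leafPoint d encV encR t ∈ F) :
    ((sampleSpace κ d R F ×ˢ (Finset.univ : Finset (Fin (2 ^ d) → R))).filter
      fun y => AsksSecret a y.1 y.1.2.2).card ≤
    2 * ((sampleSpace κ d R F ×ˢ (Finset.univ : Finset (Fin (2 ^ d) → R))).filter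
      fun y => AsksSecret a y.1 y.2).card := by
  set Ω := sampleSpace κ d R F ×ˢ (Finset.univ : Finset (Fin (2 ^ d) → R)) with hΩ
  have hmem : ∀ H b r ρ, ((H, b, r), ρ) ∈ Ω ↔ H ∈ tables κ F := by
    intro H b r ρ
    simp [hΩ, sampleSpace]
  -- The first phase sees neither `r` nor `ρ`, so the two may simply trade places.
  have hfirst : (Ω.filter fun y => AsksFirst a y.1.1 y.1.2.2).card ≤
      (Ω.filter fun y => AsksFirst a y.1.1 y.2).card := by
    refine Finset.card_le_card_of_injOn (fun y => ((y.1.1, y.1.2.1, y.2), y.1.2.2)) ?_ ?_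
    · rintro ⟨⟨H, b, r⟩, ρ⟩ hy
      simp only [Finset.coe_filter, Set.mem_ofPred_eq, hmem] at hy ⊢
      exact hy
    · rintro ⟨⟨H, b, r⟩, ρ⟩ - ⟨⟨H', b', r'⟩, ρ'⟩ - heq
      simp only [Prod.mk.injEq] at heq ⊢
      tauto
  have key : ∀ (H : Oracle κ) (b : Bool) (r ρ : Fin (2 ^ d) → R),
      ¬ AsksFirst a H r → ¬ AsksFirst a H ρ →
      let H' := relabel (leafPoint d encV encR) (swapSalts (a.run H).1 r ρ) H
      a.run H = a.run H' ∧ ¬ AsksFirst a H' (mixSalts (a.run H).1 ρ r) ∧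
      (AsksSecond a H b r r → ¬ AsksSecond a H b r ρ →
        AsksSecond a H' b (mixSalts (a.run H).1 r ρ) (mixSalts (a.run H).1 ρ r)) := by
    intro H b r ρ hr hρ H'
    have hv := sameView_swapSalts (a := a) henc H b r ρ
    have hn : ∀ x ∈ a.asked H, ¬ (IsSecret encV encR (a.run H).1 r x ∨
        IsSecret encV encR (a.run H).1 ρ x) :=
      fun x hx hs => hs.elim (fun hs => hr ⟨x, hx, hs⟩) fun hs => hρ ⟨x, hx, hs⟩
    have h1 := hv.first hn
    refine ⟨h1.1, ?_, ?_⟩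
    · rintro ⟨x, hx, hs⟩
      rw [← h1.1] at hs
      rw [← h1.2] at hx
      exact hr ⟨x, hx, hs.congr fun i hi => mixSalts_of_ne _ _ _ hi⟩
    · rintro ⟨x, hx, hs⟩ hnρ
      -- The common question is not secret for `ρ` by assumption, so it is secret for `r`, which
      -- after the exchange plays the role of the independent salts.
      obtain ⟨y, hy, hy', hs'⟩ := hv.exists_common hn ⟨x, hx, Or.inl hs⟩
      refine ⟨y, hy', ?_⟩
      rw [← h1.1]
      refine (hs'.resolve_right fun hs' => hnρ ⟨y, hy, hs'⟩).congr fun i hi => ?_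
      rw [mixSalts_of_ne _ _ _ hi]
  have hsecond : (Ω.filter fun y => ¬ AsksFirst a y.1.1 y.1.2.2 ∧ ¬ AsksFirst a y.1.1 y.2 ∧
        AsksSecond a y.1.1 y.1.2.1 y.1.2.2 y.1.2.2 ∧
        ¬ AsksSecond a y.1.1 y.1.2.1 y.1.2.2 y.2).card ≤
      (Ω.filter fun y => ¬ AsksFirst a y.1.1 y.2 ∧
        AsksSecond a y.1.1 y.1.2.1 y.1.2.2 y.2).card := by
    refine Finset.card_le_card_of_injOn (fun y =>
      ((relabel (leafPoint d encV encR) (swapSalts (a.run y.1.1).1 y.1.2.2 y.2) y.1.1, y.1.2.1,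
        mixSalts (a.run y.1.1).1 y.1.2.2 y.2), mixSalts (a.run y.1.1).1 y.2 y.1.2.2)) ?_ ?_
    · rintro ⟨⟨H, b, r⟩, ρ⟩ hy
      simp only [Finset.coe_filter, Set.mem_ofPred_eq, hmem] at hy ⊢
      obtain ⟨hH, hr, hρ, h1, h2⟩ := hy
      obtain ⟨-, h3, h4⟩ := key H b r ρ hr hρ
      exact ⟨relabel_mem_tables hF hH, h3, h4 h1 h2⟩
    · rintro ⟨⟨H, b, r⟩, ρ⟩ hy ⟨⟨H', b', r'⟩, ρ'⟩ hy' heq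
      simp only [Finset.coe_filter, Set.mem_ofPred_eq] at hy hy'
      simp only [Prod.mk.injEq] at heq
      obtain ⟨⟨h1, rfl, h2⟩, h3⟩ := heq
      have hvs : a.run H = a.run H' := by
        rw [(key H b r ρ hy.2.1 hy.2.2.1).1, h1, ← (key H' b r' ρ' hy'.2.1 hy'.2.2.1).1]
      rw [hvs] at h1 h2 h3
      have hr : r = r' := by
        rw [← mixSalts_mixSalts (a.run H').1 r ρ, h2, h3, mixSalts_mixSalts]
      have hρ : ρ = ρ' := by
        rw [← mixSalts_mixSalts (a.run H').1 ρ r, h2, h3, mixSalts_mixSalts]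
      subst hr hρ
      have h4 := congrArg (relabel (leafPoint d encV encR) (swapSalts (a.run H').1 r ρ)) h1
      rw [relabel_relabel (leafPoint_injective henc) (swapSalts_involutive _ _ _),
        relabel_relabel (leafPoint_injective henc) (swapSalts_involutive _ _ _)] at h4
      rw [h4]
  have hcover : (Ω.filter fun y => AsksSecret a y.1 y.1.2.2) ⊆
      (Ω.filter fun y => AsksSecret a y.1 y.2) ∪
      ((Ω.filter fun y => AsksFirst a y.1.1 y.1.2.2) ∪
      (Ω.filter fun y => ¬ AsksFirst a y.1.1 y.1.2.2 ∧ ¬ AsksFirst a y.1.1 y.2 ∧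
        AsksSecond a y.1.1 y.1.2.1 y.1.2.2 y.1.2.2 ∧
        ¬ AsksSecond a y.1.1 y.1.2.1 y.1.2.2 y.2)) := by
    intro y hy
    obtain ⟨hm, h⟩ := Finset.mem_filter.1 hy
    by_cases hρ : AsksSecret a y.1 y.2
    · exact Finset.mem_union_left _ (Finset.mem_filter.2 ⟨hm, hρ⟩)
    · refine Finset.mem_union_right _ ?_
      by_cases hr : AsksFirst a y.1.1 y.1.2.2
      · exact Finset.mem_union_left _ (Finset.mem_filter.2 ⟨hm, hr⟩)
      · exact Finset.mem_union_right _ (Finset.mem_filter.2 ⟨hm, hr, fun h => hρ (Or.inl h),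
          h.resolve_left hr, fun h => hρ (Or.inr h)⟩)
  -- The targets of the two injections are disjoint, so together they cost a single copy of the
  -- event for `ρ`; this is why the factor is `2` and not `3`.
  have hsplit : (Ω.filter fun y => AsksFirst a y.1.1 y.2).card +
      (Ω.filter fun y => ¬ AsksFirst a y.1.1 y.2 ∧
        AsksSecond a y.1.1 y.1.2.1 y.1.2.2 y.2).card ≤
      (Ω.filter fun y => AsksSecret a y.1 y.2).card := by
    rw [← Finset.card_union_of_disjoint]
    · refine Finset.card_le_card fun y hy => ?_
      rcases Finset.mem_union.1 hy with hy | hy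
      · exact Finset.mem_filter.2 ⟨(Finset.mem_filter.1 hy).1, Or.inl (Finset.mem_filter.1 hy).2⟩
      · exact Finset.mem_filter.2
          ⟨(Finset.mem_filter.1 hy).1, Or.inr (Finset.mem_filter.1 hy).2.2⟩
    · refine Finset.disjoint_left.2 fun y hy hy' => ?_
      exact (Finset.mem_filter.1 hy').2.1 (Finset.mem_filter.1 hy).2
  calc _ ≤ _ := Finset.card_le_card hcover
    _ ≤ _ := Finset.card_union_le _ _
    _ ≤ _ := Nat.add_le_add_left
      ((Finset.card_union_le _ _).trans ((Nat.add_le_add hfirst hsecond).trans hsplit)) _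
    _ = _ := (two_mul _).symm

-- Both sides are multiplied by the number of auxiliary vectors `ρ`, which is cancelled at the end.
open Classical in
theorem card_asksSecret_mul_le (henc : Function.Injective fun x : V × R => encV x.1 ++ encR x.2)
    [Nonempty R] {F : Finset (List Bool)} (hF : ∀ t, leafPoint d encV encR t ∈ F) {q : ℕ}
    (hq : ∀ H b r, (merkleVC κ d encV encR).hidingOracleQueries H a b r ≤ q) :
    ((sampleSpace κ d R F).filter fun z => AsksSecret a z z.2.2).card * Fintype.card R ≤
      2 * q * (sampleSpace κ d R F).card := by
  have h1 := card_asksSecret_le (a := a) henc hF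
  have h2 : ((sampleSpace κ d R F ×ˢ (Finset.univ : Finset (Fin (2 ^ d) → R))).filter
      fun y => AsksSecret a y.1 y.1.2.2).card =
      ((sampleSpace κ d R F).filter fun z => AsksSecret a z z.2.2).card *
        Fintype.card (Fin (2 ^ d) → R) := by
    rw [← Finset.card_univ, ← Finset.card_product,
      ← Finset.filter_product_left fun z => AsksSecret a z z.2.2]
  have h3 : ((sampleSpace κ d R F ×ˢ (Finset.univ : Finset (Fin (2 ^ d) → R))).filter
      fun y => AsksSecret a y.1 y.2).card * Fintype.card R ≤
      (sampleSpace κ d R F).card * (q * Fintype.card (Fin (2 ^ d) → R)) := by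
    rw [Finset.card_filter, Finset.sum_product, Finset.sum_mul, ← smul_eq_mul,
      ← Finset.sum_const]
    refine Finset.sum_le_sum fun z _ => ?_
    rw [← Finset.card_filter]
    exact card_asksSecret_fiber_mul_le henc hq z
  have hpos : 0 < Fintype.card (Fin (2 ^ d) → R) := Fintype.card_pos
  refine Nat.le_of_mul_le_mul_right ?_ hpos
  rw [h2] at h1
  calc _ = ((sampleSpace κ d R F).filter fun z => AsksSecret a z z.2.2).card *
        Fintype.card (Fin (2 ^ d) → R) * Fintype.card R := by ring
    _ ≤ 2 * ((sampleSpace κ d R F ×ˢ (Finset.univ : Finset (Fin (2 ^ d) → R))).filter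
      fun y => AsksSecret a y.1 y.2).card * Fintype.card R := Nat.mul_le_mul_right _ h1
    _ ≤ 2 * ((sampleSpace κ d R F).card * (q * Fintype.card (Fin (2 ^ d) → R))) := by
      rw [mul_assoc]
      exact Nat.mul_le_mul_left _ h3
    _ = _ := by ring

open Classical in
/-- The number of winning samples is close to one half of the number of samples. -/
theorem card_win_close (henc : Function.Injective fun x : V × R => encV x.1 ++ encR x.2)
    [Nonempty R] (hR : 2 ^ κ ≤ Fintype.card R) {F : Finset (List Bool)}
    (hF : ∀ t, leafPoint d encV encR t ∈ F) {q : ℕ}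
    (hq : ∀ H b r, (merkleVC κ d encV encR).hidingOracleQueries H a b r ≤ q) :
    |(((sampleSpace κ d R F).filter fun z =>
      (merkleVC κ d encV encR).hidingGuess z.1 a z.2.1 z.2.2 = z.2.1).card : ℝ) /
      (sampleSpace κ d R F).card - 1 / 2| ≤ q / 2 ^ κ := by
  set Ω := sampleSpace κ d R F with hΩ
  let g : Oracle κ × Bool × (Fin (2 ^ d) → R) → Bool := fun z =>
    ((merkleVC κ d encV encR).hidingGuess z.1 a z.2.1 z.2.2 ^^ z.2.1)
  have hN : 0 < Ω.card := by
    rw [hΩ, sampleSpace, Finset.card_product, Finset.card_univ]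
    exact Nat.mul_pos (tables_nonempty F).card_pos Fintype.card_pos
  have hw : (Ω.filter fun z => (merkleVC κ d encV encR).hidingGuess z.1 a z.2.1 z.2.2 = z.2.1) =
      Ω.filter fun z => g z = false :=
    Finset.filter_congr fun z _ => by simp [g]
  have h1 := card_asksSecret_mul_le (a := a) henc hF hq
  have h2 := card_win_le (a := a) henc hF false
  have h3 := card_win_le (a := a) henc hF true
  rw [← hΩ] at h1 h2 h3
  set B := (Ω.filter fun z => AsksSecret a z z.2.2).card with hB
  have hsum : (Ω.filter fun z => g z = false).card + (Ω.filter fun z => g z = true).card =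
      Ω.card := by
    rw [← Finset.card_filter_add_card_filter_not (s := Ω) (fun z => g z = false)]
    simp
  have hBsum : (Ω.filter fun z => AsksSecret a z z.2.2 ∧ g z = false).card +
      (Ω.filter fun z => AsksSecret a z z.2.2 ∧ g z = true).card = B := by
    rw [hB, ← Finset.card_filter_add_card_filter_not
      (s := Ω.filter fun z => AsksSecret a z z.2.2) (fun z => g z = false)]
    simp [Finset.filter_filter]
  have hdec : ∀ o, (Ω.filter fun z => g z = o).card =
      (Ω.filter fun z => AsksSecret a z z.2.2 ∧ g z = o).card +
      (Ω.filter fun z => ¬ AsksSecret a z z.2.2 ∧ g z = o).card := by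
    intro o
    rw [← Finset.card_filter_add_card_filter_not (s := Ω.filter fun z => g z = o)
      (fun z => AsksSecret a z z.2.2)]
    simp [Finset.filter_filter, and_comm]
  have hd0 := hdec false
  have hd1 := hdec true
  rw [hw]
  have hR' : B * 2 ^ κ ≤ 2 * q * Ω.card := (Nat.mul_le_mul_left _ hR).trans h1
  -- Here `g z = false` means a win. Off the secret-asking samples wins and losses balance, so their
  -- total difference is at most `B`.
  have e1 : 2 * (Ω.filter fun z => g z = false).card ≤ Ω.card + B := by
    simp only [Bool.not_false, Bool.not_true] at h2 h3
    change (Ω.filter fun z => ¬ AsksSecret a z z.2.2 ∧ g z = false).card ≤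
      (Ω.filter fun z => ¬ AsksSecret a z z.2.2 ∧ g z = true).card at h2
    omega
  have e2 : Ω.card ≤ 2 * (Ω.filter fun z => g z = false).card + B := by
    simp only [Bool.not_false, Bool.not_true] at h2 h3
    change (Ω.filter fun z => ¬ AsksSecret a z z.2.2 ∧ g z = true).card ≤
      (Ω.filter fun z => ¬ AsksSecret a z z.2.2 ∧ g z = false).card at h3
    omega
  generalize (Ω.filter fun z => g z = false).card = W at e1 e2 ⊢
  have hN' : (0 : ℝ) < Ω.card := by exact_mod_cast hN
  have e1' : 2 * (W : ℝ) ≤ Ω.card + B := by exact_mod_cast e1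
  have e2' : (Ω.card : ℝ) ≤ 2 * W + B := by exact_mod_cast e2
  have e3 : (B : ℝ) * 2 ^ κ ≤ 2 * q * Ω.card := by exact_mod_cast hR'
  have e4 : (B : ℝ) / (2 * Ω.card) ≤ q / 2 ^ κ := by
    rw [div_le_div_iff₀ (by positivity) (by positivity)]
    linarith
  refine le_trans ?_ e4
  rw [show (W : ℝ) / Ω.card - 1 / 2 = (2 * W - Ω.card) / (2 * Ω.card) by field_simp,
    abs_div, abs_of_pos (show (0 : ℝ) < 2 * Ω.card by positivity)]
  gcongr
  exact abs_le.2 ⟨by linarith, by linarith⟩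

end Counting

/-! ### From counts to the hiding probability -/

section Hiding

variable {κ d : ℕ} {V R : Type} {encV : V → List Bool} {encR : R → List Bool}

theorem dependsOnFinite_leafHashes (v : Fin (2 ^ d) → V) (r : Fin (2 ^ d) → R) (j : ℕ) :
    DependsOnFinite fun H : Oracle κ => leafHashes encV encR H v r j := by
  unfold leafHashes
  split_ifs with h
  · exact dependsOnFinite_eval _
  · exact dependsOnFinite_const _

theorem dependsOnFinite_hidingGuess [Finite R] (a : (merkleVC κ d encV encR).HidingStrategy)
    (b : Bool) (r : Fin (2 ^ d) → R) :
    DependsOnFinite fun H => (merkleVC κ d encV encR).hidingGuess H a b r := by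
  have : ∀ q, Finite ((merkleVC κ d encV encR).GuessAnswer q) := by
    rintro (x | i)
    · exact inferInstanceAs (Finite (Hash κ))
    · exact inferInstanceAs (Finite (Option (R × (Fin d → Hash κ))))
  have hanswer : ∀ (vs : Bool → Fin (2 ^ d) → V) q,
      DependsOnFinite fun H => (merkleVC κ d encV encR).guessAnswer H vs b r q := by
    rintro vs (x | i)
    · exact dependsOnFinite_eval x
    · simp only [VCScheme.guessAnswer]
      split_ifs with h
      · exact (DependsOnFinite.pi fun n : Fin d => dependsOnFinite_nodeHash d
          (dependsOnFinite_leafHashes (encV := encV) (encR := encR) (vs b) r) n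
          (sibling (i / 2 ^ (n : ℕ)))).comp fun w => some (r i, w)
      · exact dependsOnFinite_const _
  refine DependsOnFinite.run (Ans := fun _ => Hash κ) (answer := fun H => H)
    (g := fun c H => (c.2 ((merkleVC κ d encV encR).commit H (c.1 b) r)).run
      ((merkleVC κ d encV encR).guessAnswer H c.1 b r))
    (fun q => dependsOnFinite_eval q) (fun c => ?_) a
  have : Finite (merkleVC κ d encV encR).Com := inferInstanceAs (Finite (Hash κ))
  refine DependsOnFinite.bind
    (f := fun H => (merkleVC κ d encV encR).commit H (c.1 b) r)
    (g := fun C H => (c.2 C).run ((merkleVC κ d encV encR).guessAnswer H c.1 b r))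
    (dependsOnFinite_nodeHash d (dependsOnFinite_leafHashes _ r) d 0) fun C => ?_
  exact DependsOnFinite.run (g := fun o _ => o) (hanswer c.1) dependsOnFinite_const (c.2 C)

theorem tsum_bind_mul {α β : Type} (A : PMF α) (f : α → PMF β) (g : β → ℝ≥0∞) :
    ∑' y, A.bind f y * g y = ∑' x, A x * ∑' y, f x y * g y := by
  simp_rw [PMF.bind_apply, ← ENNReal.tsum_mul_right, ← ENNReal.tsum_mul_left]
  rw [ENNReal.tsum_comm]
  simp_rw [mul_assoc]

theorem tsum_pure_mul {β : Type} (y : β) (g : β → ℝ≥0∞) :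
    ∑' z, PMF.pure y z * g z = g y := by
  classical
  rw [tsum_eq_single y fun z hz => by rw [PMF.pure_apply, if_neg hz, zero_mul],
    PMF.pure_apply, if_pos rfl, one_mul]

theorem tsum_uniformOfFintype_mul {β : Type} [Fintype β] [Nonempty β] (g : β → ℝ≥0∞) :
    ∑' z, PMF.uniformOfFintype β z * g z = (Fintype.card β : ℝ≥0∞)⁻¹ * ∑ z, g z := by
  simp [tsum_fintype, Finset.mul_sum]

variable [Fintype R] [Nonempty R]

/-- The probability that the deterministic strategy `a` guesses the bit. -/
noncomputable def guessProb (a : (merkleVC κ d encV encR).HidingStrategy) : ℝ≥0∞ :=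
  (Fintype.card Bool : ℝ≥0∞)⁻¹ * ∑ b, (Fintype.card (Fin (2 ^ d) → R) : ℝ≥0∞)⁻¹ *
    ∑ r, oracleLaw κ {H | (merkleVC κ d encV encR).hidingGuess H a b r = b}

theorem hidingProb_eq (A : PMF (merkleVC κ d encV encR).HidingStrategy) :
    (merkleVC κ d encV encR).hidingProb A = (∑' a, A a * guessProb a).toReal := by
  rw [VCScheme.hidingProb, romProb, tsum_bind_mul]
  simp only [tsum_bind_mul, tsum_pure_mul, tsum_uniformOfFintype_mul]
  rfl

open Classical in
theorem guessProb_eq (a : (merkleVC κ d encV encR).HidingStrategy) {F : Finset (List Bool)}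
    (hF : ∀ b r, DependsOn (fun H => (merkleVC κ d encV encR).hidingGuess H a b r)
      (F : Set (List Bool))) :
    guessProb a = ENNReal.ofReal ((((sampleSpace κ d R F).filter fun z =>
      (merkleVC κ d encV encR).hidingGuess z.1 a z.2.1 z.2.2 = z.2.1).card : ℝ) /
      (sampleSpace κ d R F).card) := by
  have h0 : ((sampleSpace κ d R F).filter fun z =>
      (merkleVC κ d encV encR).hidingGuess z.1 a z.2.1 z.2.2 = z.2.1).card =
      ∑ b, ∑ r, ((tables κ F).filter fun H =>
        (merkleVC κ d encV encR).hidingGuess H a b r = b).card := by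
    simp only [Finset.card_filter, sampleSpace]
    rw [Finset.sum_product_right, ← Finset.univ_product_univ, Finset.sum_product]
  have hN : (sampleSpace κ d R F).card =
      (tables κ F).card * (Fintype.card Bool * Fintype.card (Fin (2 ^ d) → R)) := by
    rw [sampleSpace, Finset.card_product, Finset.card_univ, Fintype.card_prod]
  have hpos : 0 < (sampleSpace κ d R F).card := by
    rw [hN]
    exact Nat.mul_pos (tables_nonempty F).card_pos (Nat.mul_pos Fintype.card_pos Fintype.card_pos)
  rw [ENNReal.ofReal_div_of_pos (by exact_mod_cast hpos), ENNReal.ofReal_natCast,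
    ENNReal.ofReal_natCast, h0, hN, guessProb]
  have hlaw : ∀ b r, oracleLaw κ {H | (merkleVC κ d encV encR).hidingGuess H a b r = b} =
      (((tables κ F).filter fun H =>
        (merkleVC κ d encV encR).hidingGuess H a b r = b).card : ℝ≥0∞) *
        ((tables κ F).card : ℝ≥0∞)⁻¹ := fun b r => by
    rw [oracleLaw_eq_div F fun H H' h => by simp only [hF b r h], ENNReal.div_eq_inv_mul,
      mul_comm]
    congr!
  simp only [hlaw]
  push_cast
  have hT : ((tables κ F).card : ℝ≥0∞) ≠ ⊤ := ENNReal.natCast_ne_top _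
  rw [ENNReal.div_eq_inv_mul, ENNReal.mul_inv (Or.inr (by finiteness)) (Or.inl hT),
    ENNReal.mul_inv (Or.inr (by finiteness)) (Or.inl (by simp)), Finset.mul_sum, Finset.mul_sum]
  refine Finset.sum_congr rfl fun b _ => ?_
  rw [← Finset.sum_mul]
  ring

theorem guessProb_close [Finite V]
    (henc : Function.Injective fun x : V × R => encV x.1 ++ encR x.2)
    (hR : 2 ^ κ ≤ Fintype.card R) (a : (merkleVC κ d encV encR).HidingStrategy) {q : ℕ}
    (hq : ∀ H b r, (merkleVC κ d encV encR).hidingOracleQueries H a b r ≤ q) :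
    ∃ x : ℝ, 0 ≤ x ∧ guessProb a = ENNReal.ofReal x ∧ |x - 1 / 2| ≤ q / 2 ^ κ := by
  classical
  choose G hG using fun z : Bool × (Fin (2 ^ d) → R) => dependsOnFinite_hidingGuess a z.1 z.2
  -- `F` must decide the guess for all `b` and `r`, and must contain all leaf points so that
  -- relabelling maps tables on `F` to tables on `F`.
  let F : Finset (List Bool) := Finset.univ.biUnion G ∪
    (Set.finite_range (leafPoint d encV encR)).toFinset
  have hF : ∀ t, leafPoint d encV encR t ∈ F := fun t => by simp [F]
  have hdep : ∀ b r, DependsOn (fun H => (merkleVC κ d encV encR).hidingGuess H a b r)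
      (F : Set (List Bool)) := fun b r H H' h => hG (b, r) fun x hx => h x (by
    refine Finset.mem_coe.2 (Finset.mem_union_left _ (Finset.mem_biUnion.2 ⟨(b, r), ?_, hx⟩))
    exact Finset.mem_univ _)
  exact ⟨_, by positivity, guessProb_eq a hdep, card_win_close henc hR hF hq⟩

theorem merkleVC_hidingProb_close [Finite V]
    (henc : Function.Injective fun x : V × R => encV x.1 ++ encR x.2)
    (hR : 2 ^ κ ≤ Fintype.card R) (q : ℕ) (A : PMF (merkleVC κ d encV encR).HidingStrategy)
    (hA : ∀ a ∈ A.support, ∀ H b r,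
      (merkleVC κ d encV encR).hidingOracleQueries H a b r ≤ q) :
    |(merkleVC κ d encV encR).hidingProb A - 1 / 2| ≤ q / 2 ^ κ := by
  have hε : (0 : ℝ) ≤ q / 2 ^ κ := by positivity
  have hone : ∀ c : ℝ≥0∞, ∑' a, A a * c = c := fun c => by
    rw [ENNReal.tsum_mul_right, A.tsum_coe, one_mul]
  have hmono : ∀ f g : (merkleVC κ d encV encR).HidingStrategy → ℝ≥0∞,
      (∀ a ∈ A.support, f a ≤ g a) → ∑' a, A a * f a ≤ ∑' a, A a * g a := by
    intro f g h
    refine ENNReal.tsum_le_tsum fun a => ?_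
    by_cases ha : a ∈ A.support
    · gcongr
      exact h a ha
    · rw [PMF.mem_support_iff, not_not] at ha
      simp [ha]
  have hup : ∑' a, A a * guessProb a ≤ ENNReal.ofReal (1 / 2 + q / 2 ^ κ) := by
    rw [← hone (ENNReal.ofReal _)]
    refine hmono _ _ fun a ha => ?_
    obtain ⟨x, -, hx, hc⟩ := guessProb_close henc hR a (hA a ha)
    rw [hx]
    exact ENNReal.ofReal_le_ofReal (by linarith [(abs_le.1 hc).2])
  -- The lower bound is stated additively, since subtraction of extended nonnegative reals
  -- truncates.
  have hlow : ENNReal.ofReal (1 / 2) ≤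
      ∑' a, A a * guessProb a + ENNReal.ofReal (q / 2 ^ κ) := by
    rw [← hone (ENNReal.ofReal (1 / 2)), ← hone (ENNReal.ofReal (q / 2 ^ κ)),
      ← ENNReal.tsum_add]
    simp_rw [← mul_add]
    refine hmono _ _ fun a ha => ?_
    obtain ⟨x, hx0, hx, hc⟩ := guessProb_close henc hR a (hA a ha)
    rw [hx, ← ENNReal.ofReal_add hx0 hε]
    exact ENNReal.ofReal_le_ofReal (by linarith [(abs_le.1 hc).1])
  have hfin : ∑' a, A a * guessProb a ≠ ⊤ := ne_top_of_le_ne_top ENNReal.ofReal_ne_top hup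
  rw [hidingProb_eq, abs_le]
  constructor
  · have := ENNReal.toReal_mono (by finiteness) hlow
    rw [ENNReal.toReal_add hfin ENNReal.ofReal_ne_top, ENNReal.toReal_ofReal (by norm_num),
      ENNReal.toReal_ofReal hε] at this
    linarith
  · have := ENNReal.toReal_mono ENNReal.ofReal_ne_top hup
    rw [ENNReal.toReal_ofReal (by positivity)] at this
    linarith

end Hiding

theorem hidingOracleQueries_le {κ L : ℕ} {V R : Type} (S : VCScheme κ L V R) (H : Oracle κ)
    (a : S.HidingStrategy) (b : Bool) (r : Fin L → R) :
    S.hidingOracleQueries H a b r ≤ S.hidingQueries H a b r :=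
  Nat.add_le_add_left List.countP_le_length _

end SaltedMerkle

/-! ### Assembling the theorem -/

theorem mainTheorem2 (d : ℕ) (V R : ℕ → Type)
    [∀ κ, Finite (V κ)] [∀ κ, Fintype (R κ)] [∀ κ, Nonempty (R κ)]
    (hR : ∀ κ, 2 ^ κ ≤ Fintype.card (R κ))
    (encV : ∀ κ, V κ → List Bool) (encR : ∀ κ, R κ → List Bool)
    (henc : ∀ κ, Function.Injective fun x : V κ × R κ => encV κ x.1 ++ encR κ x.2) :
    SaltedMerkle.IsGoodVC (fun κ => SaltedMerkle.merkleVC κ d (encV κ) (encR κ)) ∧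
    (∀ (κ q : ℕ)
      (A : PMF (SaltedMerkle.merkleVC κ d (encV κ) (encR κ)).BindingStrategy),
      (∀ a ∈ A.support, ∀ H : SaltedMerkle.Oracle κ, (a.asked H).length ≤ q) →
      (SaltedMerkle.merkleVC κ d (encV κ) (encR κ)).bindingProb A
        ≤ ((q : ℝ) + 2 * (2 ^ (d + 1) - 1)) ^ 2 / 2 ^ κ) ∧
    (∀ (κ q : ℕ)
      (A : PMF (SaltedMerkle.merkleVC κ d (encV κ) (encR κ)).PositionStrategy),
      (∀ a ∈ A.support, ∀ H : SaltedMerkle.Oracle κ, (a.asked H).length ≤ q) →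
      (SaltedMerkle.merkleVC κ d (encV κ) (encR κ)).positionProb A
        ≤ ((q : ℝ) + 2 * (d + 1)) ^ 2 / 2 ^ κ) ∧
    (∀ (κ q : ℕ)
      (A : PMF (SaltedMerkle.merkleVC κ d (encV κ) (encR κ)).HidingStrategy),
      (∀ a ∈ A.support, ∀ (H : SaltedMerkle.Oracle κ) (b : Bool) (r : Fin (2 ^ d) → R κ),
        (SaltedMerkle.merkleVC κ d (encV κ) (encR κ)).hidingOracleQueries H a b r ≤ q) →
      |(SaltedMerkle.merkleVC κ d (encV κ) (encR κ)).hidingProb A - 1 / 2|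
        ≤ (q : ℝ) / 2 ^ κ) := by
  have hbind := fun κ => SaltedMerkle.merkleVC_bindingProb_le (κ := κ) (d := d) (henc κ)
  have hpos := fun κ => SaltedMerkle.merkleVC_positionProb_le (κ := κ) (d := d) (henc κ)
  have hhide := fun κ => SaltedMerkle.merkleVC_hidingProb_close (d := d) (henc κ) (hR κ)
  have heval : ∀ (p : Polynomial ℕ) (κ : ℕ),
      (p.map (Nat.castRingHom ℝ)).eval (κ : ℝ) = ((p.eval κ : ℕ) : ℝ) := fun p κ =>
    Polynomial.eval_natCast_map (Nat.castRingHom ℝ) p κ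
  refine ⟨⟨fun κ => SaltedMerkle.merkleVC_correct, ?_, ?_, ?_⟩, hbind, hpos, hhide⟩
  -- With `q = p.eval κ` the explicit bound is a fixed real polynomial in `κ` over `2 ^ κ`, because
  -- `d` does not vary with `κ`.
  · rintro A ⟨p, hp⟩
    refine SaltedMerkle.negligible_of_le_polynomial_div
      ((p.map (Nat.castRingHom ℝ) + Polynomial.C (2 * (2 ^ (d + 1) - 1))) ^ 2) fun κ => ?_
    rw [Polynomial.eval_pow, Polynomial.eval_add, Polynomial.eval_C, heval]
    exact hbind κ _ (A κ) (hp κ)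
  · rintro A ⟨p, hp⟩
    refine SaltedMerkle.negligible_of_le_polynomial_div
      ((p.map (Nat.castRingHom ℝ) + Polynomial.C (2 * ((d : ℝ) + 1))) ^ 2) fun κ => ?_
    rw [Polynomial.eval_pow, Polynomial.eval_add, Polynomial.eval_C, heval]
    exact hpos κ _ (A κ) (hp κ)
  · rintro A ⟨p, hp⟩
    refine SaltedMerkle.negligible_of_le_polynomial_div
      (p.map (Nat.castRingHom ℝ)) fun κ => ?_
    rw [heval]
    exact hhide κ _ (A κ) fun a ha H b r =>
      (SaltedMerkle.hidingOracleQueries_le _ H a b r).trans (hp κ a ha H b r)
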